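/- **Setting.** Let $f,R:\mathbb R^p\to\mathbb R\cup\{+\infty\}$ be proper, closed and convex, $F:=f+R$, and let $f$ be standard self-concordant: $\operatorname{dom} f$ is open, $f\in C^3(\operatorname{dom} f)$, and for all $x\in\operatorname{dom} f$, $v\in\mathbb R^p$ the function $\varphi(\tau)=f(x+\tau v)$ satisfies $|\varphi'''|\le 2(\varphi'')^{3/2}$ on its domain. For a symmetric positive definite matrix $H(x)$ write $|||u|||_x=(u^\top H(x)u)^{1/2}$ and $|||v|||_x^*=(v^\top H(x)^{-1}v)^{1/2}$; let $\omega(\tau)=\tau-\ln(1+\tau)$ and $\omega_*(\tau)=-\tau-\ln(1-\tau)$. Let $\mathcal X\subseteq\operatorname{dom} f$, let $\delta_0,\delta_3\in[0,1)$, $\delta_1,\delta_2\ge 0$, and let $(\tilde f,g,H)$ be a $(\delta_0,\delta_1,\delta_2,\delta_3)$-local inexact second-order oracle of $f$ on $\mathcal X$: for all $x\in\mathcal X$, $H(x)\succ0$, $|||g(x)-\nabla f(x)|||_x^*\le\delta_2$, $(1-\delta_3)^2\nabla^2f(x)\preceq H(x)\preceq(1+\delta_3)^2\nabla^2f(x)$,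 and every $y$ with $|||y-x|||_x<\frac1{1+\delta_0}$ lies in $\operatorname{dom} f$ and satisfies $$\omega\big((1-\delta_0)|||y-x|||_x\big)\le f(y)-\tilde f(x)-\langle g(x),y-x\rangle\le\omega_*\big((1+\delta_0)|||y-x|||_x\big)+\delta_1 .$$ Let $\delta_4\in[0,1)$ and let $\{x^k\}\subset\mathcal X$, $x^0\in\operatorname{dom}F$, be generated by the inexact proximal Newton algorithm with damped step size: $z^k$ is such that there is $\nu^k\in g(x^k)+H(x^k)(z^k-x^k)+\partial R(z^k)$ with $|||\nu^k|||^*_{x^k}\le\delta_4\lambda_k$, where $\lambda_k:=|||z^k-x^k|||_{x^k}$, and $$x^{k+1}=x^k+\alpha_k(z^k-x^k),\qquad \alpha_k=\frac{1-\delta_4}{(1+\delta_0)(1+\delta_0+(1-\delta_4)\lambda_k)} .$$ **Theorem.** Suppose that $0\le\delta_3,\delta_4\le\delta\le\frac1{100}$ and $\delta_0=\delta$. For every $k$ with $\lambda_k\le\frac1{20}$, $$\lambda_{k+1}\le\tfrac1{10}\big(41\lambda_k^2+125\,\delta\lambda_k+21\,\delta_2\big).$$ Moreover, for every $\varepsilon\in(0,\frac1{20})$,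 if $\lambda_0\le\frac1{20}$, then: (a) (linear rate) if $\delta_2=\frac{5\varepsilon}{32}$, then $\lambda_k\le\varepsilon$ for $k=\lfloor\ln\frac1\varepsilon\rfloor$; (b) (superlinear rate) if $\delta\le\frac14\big(\frac35\big)^{\ln(1/\varepsilon)}$ and $0\le\delta_2\le\frac{37}{20}\big(\frac{11}{50}\big)^{\ln(1/\varepsilon)}$, then $\lambda_k\le\varepsilon$ for $k=\lfloor\log_{3/2}(\ln\frac1\varepsilon)\rfloor$; (c) (quadratic rate) if $\delta\le\frac1{10}\big(\frac{19}{50}\big)^{\ln(1/\varepsilon)}$ and $0\le\delta_2\le\frac15\big(\frac{13}{50}\big)^{\ln(1/\varepsilon)}$, then $\lambda_k\le\varepsilon$ for $k=\lfloor\log_2(\ln\frac1\varepsilon)\rfloor$. In addition (for arbitrary $\delta_0,\delta_3,\delta_4\in[0,1)$), there is an absolute constant $C>0$ such that, for every $k$ with $\lambda_k\le\frac1{4(1+\delta_0)}$, and if $\delta_1\le1$, the set $\partial F(z^k)$ is nonempty and $$\inf_{w\in\partial F(z^k)}|||w|||^*_{x^k}\le C\big(\lambda_k+\sqrt{\delta_1}\big).$$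 Hence, for all $c_1,c_2>0$ there is a constant $K>0$, depending only on $c_1$ and $c_2$, such that for every $\varepsilon>0$ and every $k$, if $\lambda_k\le c_1\varepsilon\le\frac1{4(1+\delta_0)}$ and $\delta_1\le c_2\varepsilon^2\le1$, then $\inf_{w\in\partial F(z^k)}|||w|||^*_{x^k}\le K\varepsilon$. -/

import Mathlib

namespace InexactProxNewton

noncomputable section

/-- The space `ℝ^p` with its Euclidean structure. -/
abbrev Vec (p : ℕ) : Type := EuclideanSpace ℝ (Fin p)

/-- Linear operators (that is, `p × p` matrices) on `ℝ^p`. Between two of them, `≤` is the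
Loewner order. -/
abbrev Op (p : ℕ) : Type := Vec p →L[ℝ] Vec p

/-! ### Extended-valued convex functions

A function `ℝ^p → ℝ ∪ {+∞}` is given by its domain `D` (the set where it is finite) and by a
function `f : ℝ^p → ℝ` whose values on `D` are those of the function; the values of `f` outside
`D` play no role. -/

/-- The function with domain `D` and values `f` is proper, closed and convex. -/
structure ProperClosedConvex {p : ℕ} (D : Set (Vec p)) (f : Vec p → ℝ) : Prop where
  nonempty : D.Nonempty
  convexOn : ConvexOn ℝ D f
  isClosed_epigraph : IsClosed {q : Vec p × ℝ | q.1 ∈ D ∧ f q.1 ≤ q.2}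

/-- The subdifferential at `x` of the function with domain `D` and values `f` (empty for `x`
outside of the domain). -/
def subdifferential {p : ℕ} (D : Set (Vec p)) (f : Vec p → ℝ) (x : Vec p) : Set (Vec p) :=
  {w | x ∈ D ∧ ∀ u ∈ D, f x + inner ℝ w (u - x) ≤ f u}

/-! ### Self-concordance -/

/-- A univariate convex function `φ`, of class `C³` on its open domain `S`, is
`M`-self-concordant. -/
structure SelfConcordantOnLine (M : ℝ) (S : Set ℝ) (φ : ℝ → ℝ) : Prop where
  isOpen : IsOpen S
  convexOn : ConvexOn ℝ S φ
  contDiffOn : ContDiffOn ℝ 3 φ S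
  bound : ∀ t ∈ S, |iteratedDeriv 3 φ t| ≤ M * (iteratedDeriv 2 φ t) ^ (3 / 2 : ℝ)

/-- `f`, of class `C³` on its open domain `D`, is standard self-concordant: all its restrictions
to lines are `2`-self-concordant. -/
structure StandardSelfConcordant {p : ℕ} (D : Set (Vec p)) (f : Vec p → ℝ) : Prop where
  isOpen : IsOpen D
  contDiffOn : ContDiffOn ℝ 3 f D
  onLines : ∀ x ∈ D, ∀ v : Vec p,
    SelfConcordantOnLine 2 {t : ℝ | x + t • v ∈ D} (fun t => f (x + t • v))

/-- The Hessian `∇²f(x)`. -/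
def hessian {p : ℕ} (f : Vec p → ℝ) (x : Vec p) : Op p :=
  fderiv ℝ (gradient f) x

/-! ### Weighted norms -/

/-- `A` is symmetric positive definite. -/
def IsPosDef {p : ℕ} (A : Op p) : Prop :=
  (A : Vec p →ₗ[ℝ] Vec p).IsSymmetric ∧ ∀ u : Vec p, u ≠ 0 → 0 < inner ℝ (A u) u

/-- The weighted norm `(uᵀ A u)^{1/2}`. -/
def weightedNorm {p : ℕ} (A : Op p) (u : Vec p) : ℝ :=
  √(inner ℝ (A u) u)

/-- The dual weighted norm `(vᵀ A⁻¹ v)^{1/2}`. -/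
def dualNorm {p : ℕ} (A : Op p) (v : Vec p) : ℝ :=
  √(inner ℝ (A.inverse v) v)

/-! ### Inexact oracles -/

/-- `ω(τ) = τ - ln(1 + τ)`. -/
def omega (τ : ℝ) : ℝ := τ - Real.log (1 + τ)

/-- `ω_*(τ) = -τ - ln(1 - τ)`. -/
def omegaStar (τ : ℝ) : ℝ := -τ - Real.log (1 - τ)

/-- `(ftil, g, H)` is a `(δ₀, δ₁, δ₂, δ₃)`-local inexact second-order oracle, on the subset `X`
of the domain `D`, of the function with domain `D` and values `f`. -/
structure LocalInexactOracle {p : ℕ} (D : Set (Vec p)) (f : Vec p → ℝ) (X : Set (Vec p))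
    (ftil : Vec p → ℝ) (g : Vec p → Vec p) (H : Vec p → Op p) (δ₀ δ₁ δ₂ δ₃ : ℝ) : Prop where
  delta0_nonneg : 0 ≤ δ₀
  delta0_lt_one : δ₀ < 1
  delta1_nonneg : 0 ≤ δ₁
  delta2_nonneg : 0 ≤ δ₂
  delta3_nonneg : 0 ≤ δ₃
  delta3_lt_one : δ₃ < 1
  subset_dom : X ⊆ D
  posDef : ∀ x ∈ X, IsPosDef (H x)
  mem_dom : ∀ x ∈ X, ∀ y, weightedNorm (H x) (y - x) < 1 / (1 + δ₀) → y ∈ D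
  lower : ∀ x ∈ X, ∀ y, weightedNorm (H x) (y - x) < 1 / (1 + δ₀) →
    omega ((1 - δ₀) * weightedNorm (H x) (y - x)) ≤ f y - ftil x - inner ℝ (g x) (y - x)
  upper : ∀ x ∈ X, ∀ y, weightedNorm (H x) (y - x) < 1 / (1 + δ₀) →
    f y - ftil x - inner ℝ (g x) (y - x) ≤
      omegaStar ((1 + δ₀) * weightedNorm (H x) (y - x)) + δ₁
  gradient_error : ∀ x ∈ X, dualNorm (H x) (g x - gradient f x) ≤ δ₂
  hessian_lower : ∀ x ∈ X, (1 - δ₃) ^ 2 • hessian f x ≤ H x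
  hessian_upper : ∀ x ∈ X, H x ≤ (1 + δ₃) ^ 2 • hessian f x

/-! ### The inexact proximal Newton algorithm -/

/-- The inexact Newton decrement `λ_k`, the weighted norm of `d^k = z^k - x^k` at `x^k`. -/
def decrement {p : ℕ} (H : Vec p → Op p) (x z : ℕ → Vec p) (k : ℕ) : ℝ :=
  weightedNorm (H (x k)) (z k - x k)

/-- The damped step size, as a function of `δ₀`, `δ₄` and of the Newton decrement. -/
def dampedStep (δ₀ δ₄ lam : ℝ) : ℝ :=
  (1 - δ₄) / ((1 + δ₀) * (1 + δ₀ + (1 - δ₄) * lam))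

/-- `(x^k)` and `(z^k)` are generated by the inexact proximal Newton algorithm, with the inexact
gradients `g`, the inexact Hessians `H`, the accuracy `δ₄` of the subproblems and the damped step
size, for the regularizer with domain `DR` and values `R`. -/
structure IsDampedIPNA {p : ℕ} (DR : Set (Vec p)) (R : Vec p → ℝ) (g : Vec p → Vec p)
    (H : Vec p → Op p) (δ₀ δ₄ : ℝ) (x z : ℕ → Vec p) : Prop where
  /-- `z^k` meets the stopping criterion for the quadratic subproblem at `x^k`: some `ν^k` in
  `g(x^k) + H(x^k)(z^k - x^k) + ∂R(z^k)` has dual norm at most `δ₄ λ_k`. -/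
  stopping : ∀ k, ∃ ν : Vec p,
    ν - (g (x k) + H (x k) (z k - x k)) ∈ subdifferential DR R (z k) ∧
      dualNorm (H (x k)) ν ≤ δ₄ * weightedNorm (H (x k)) (z k - x k)
  step : ∀ k, x (k + 1) = x k + dampedStep δ₀ δ₄ (decrement H x z k) • (z k - x k)

/-- The residual of `z` as a minimizer of `F = f + R`, the infimum of the dual norms (with weight
`A`) of the subgradients of `F` at `z`. -/
def subgradientResidual {p : ℕ} (Df : Set (Vec p)) (f : Vec p → ℝ) (DR : Set (Vec p))
    (R : Vec p → ℝ) (A : Op p) (z : Vec p) : ℝ :=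
  sInf (dualNorm A '' subdifferential (Df ∩ DR) (fun u => f u + R u) z)

end

end InexactProxNewton

open InexactProxNewton

/-! The rates come from a recursion for the decrement. Let d and d' be consecutive Newton
directions, A and A' the approximate Hessians, x' = x + αd. The stopping criterion yields
subgradients of R at z and z', and monotonicity of ∂R gives ⟨b - A'd', d' - (1-α)d⟩ ≥ 0, where b
collects the residuals ν, the gradient errors and the linearization error Ad - (∇f(x') - ∇f(x)).
Completing a square (`weightedNorm_sq_le_of_inner_nonneg`) gives ‖d'‖² ≤ ‖(1-α)d‖² + ‖b‖_*² in the
norms of A'. For exact data the two terms are about λ² and 2λ² before squaring, so the leading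
coefficient is near √5, where the triangle inequality would give 3. This is `decrement_sq_le`.

Comparing the norms at x and x' and bounding the linearization error both need the Hessian to vary
by at most (1-tr)⁻² along the step (`hessForm_line_bounds`). This follows by integrating
|D³f[h,v,v]| ≤ 2‖h‖‖v‖², whereas self-concordance on lines only controls D³f[v,v,v]. The passage to
mixed arguments loses no constant: on the plane of h and v, the polar form of a cubic is a
combination of three values of the cubic, with coefficients of total absolute value 1
(`abs_cubic_polar_le`).

With the damped step size this becomes a scalar recursion (`dampedStep_bounds`,
`decrement_le_of_sq_le`). Case (a) is a contraction. In (b) and (c), for large k, λ_j is compared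
with max(ε, c·exp(-β^(j+1))), β = 3/2 or 2; since ln(1/ε) < β^(k+1), the maximum is ε at j = k. The
few small values of k are treated by explicit iteration.

For the residual, ∇f(z) - g(x) is bounded from function values alone: convexity at z is tested at
points at distance ρ, the oracle sandwiches the values, and ρ is taken proportional to λ + √δ₁
(`inner_gradient_sub_le`). -/

namespace InexactProxNewton

/-! ### Sharp polarization of binary cubic forms -/

section CubicForms

/-- Interpolation formula (of Riesz–Szegő type) for the polar form of a binary cubic form, with
nodes at the angles `u`, `u + π/3` and `u + 2π/3` (`s = sin u`, `c = cos u`, `w = √3`). -/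
lemma cubic_interpolation {c0 c1 c2 c3 s c w : ℝ} (hsc : s ^ 2 + c ^ 2 = 1) (hw : w ^ 2 = 3)
    {P : ℝ → ℝ → ℝ}
    (hP : ∀ a b, P a b = c0 * a ^ 3 + 3 * c1 * a ^ 2 * b + 3 * c2 * a * b ^ 2 + c3 * b ^ 3) :
    (3 * s - 4 * s ^ 3) ^ 3 * c1 =
      16 / 9 * ((s / 2 + w / 2 * c) ^ 2 * (-s / 2 + w / 2 * c) ^ 2) * P (2 * s * c) s
      - 16 / 9 * (s ^ 2 * (-s / 2 + w / 2 * c) ^ 2) *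
        P (s * c - w / 2 * (2 * c ^ 2 - 1)) (s / 2 + w / 2 * c)
      + 16 / 9 * (s ^ 2 * (s / 2 + w / 2 * c) ^ 2) *
        P (-s * c - w / 2 * (2 * c ^ 2 - 1)) (-s / 2 + w / 2 * c) := by
  have hc2 : c ^ 2 = 1 - s ^ 2 := by linarith
  have hc3 : c ^ 3 = c * (1 - s ^ 2) := by rw [← hc2]; ring
  have hc4 : c ^ 4 = (1 - s ^ 2) ^ 2 := by rw [← hc2]; ring
  have hc5 : c ^ 5 = c * (1 - s ^ 2) ^ 2 := by rw [← hc2]; ring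
  have hc6 : c ^ 6 = (1 - s ^ 2) ^ 3 := by rw [← hc2]; ring
  have hc7 : c ^ 7 = c * (1 - s ^ 2) ^ 3 := by rw [← hc2]; ring
  have hw4 : w ^ 4 = 9 := by rw [show w ^ 4 = (w ^ 2) ^ 2 by ring, hw]; norm_num
  simp only [hP]
  ring_nf
  simp only [hw, hw4, hc2, hc3, hc4, hc5, hc6, hc7]
  ring

/-- A binary cubic form that is bounded by `M` on the unit circle of a definite quadratic form has
polar form bounded by `M`. -/
lemma abs_cubic_polar_le_of_unit {c0 c1 c2 c3 ρ M : ℝ} (hρ : |ρ| < 1)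
    (h : ∀ a b : ℝ, |c0 * a ^ 3 + 3 * c1 * a ^ 2 * b + 3 * c2 * a * b ^ 2 + c3 * b ^ 3| ≤
      M * √(a ^ 2 + 2 * ρ * a * b + b ^ 2) ^ 3) : |c1| ≤ M := by
  obtain ⟨hρ1, hρ2⟩ := abs_lt.1 hρ
  -- With ρ = cos φ, the points (sin(φ - θ), sin θ) satisfy a² + 2ρab + b² = sin²φ. The nodes are θ
  -- = φ/3, φ/3 + π/3, φ/3 + 2π/3, and S below is sin φ, by the triple-angle formula.
  set φ := Real.arccos ρ with hφ
  set s := Real.sin (φ / 3) with hs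
  set c := Real.cos (φ / 3) with hc
  have hsc : s ^ 2 + c ^ 2 = 1 := Real.sin_sq_add_cos_sq _
  have hw : √(3 : ℝ) ^ 2 = 3 := Real.sq_sqrt (by norm_num)
  set w := √(3 : ℝ)
  have hcos : 4 * c ^ 3 - 3 * c = ρ := by
    rw [hc, ← Real.cos_three_mul, show 3 * (φ / 3) = φ by ring, hφ,
      Real.cos_arccos hρ1.le hρ2.le]
  have hsin : 0 < 3 * s - 4 * s ^ 3 := by
    rw [hs, ← Real.sin_three_mul, show 3 * (φ / 3) = φ by ring, hφ, Real.sin_arccos]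
    exact Real.sqrt_pos.2 (by nlinarith)
  set S := 3 * s - 4 * s ^ 3 with hS
  set P : ℝ → ℝ → ℝ :=
    fun a b => c0 * a ^ 3 + 3 * c1 * a ^ 2 * b + 3 * c2 * a * b ^ 2 + c3 * b ^ 3
  have key := cubic_interpolation hsc hw (P := P) (fun _ _ => rfl)
  have hc2 : c ^ 2 = 1 - s ^ 2 := by linarith
  have hc4 : c ^ 4 = (1 - s ^ 2) ^ 2 := by rw [← hc2]; ring
  have hc6 : c ^ 6 = (1 - s ^ 2) ^ 3 := by rw [← hc2]; ring
  have node : ∀ a b : ℝ, a ^ 2 + 2 * ρ * a * b + b ^ 2 = S ^ 2 → |P a b| ≤ M * S ^ 3 := by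
    intro a b hab
    have := h a b
    rwa [hab, Real.sqrt_sq hsin.le] at this
  have n0 := node (2 * s * c) s (by
    rw [← hcos, hS]; ring_nf; simp only [hc2, hc4]; ring)
  have n1 := node (s * c - w / 2 * (2 * c ^ 2 - 1)) (s / 2 + w / 2 * c) (by
    rw [← hcos, hS]; ring_nf; simp only [hw, hc2, hc4, hc6]; ring)
  have n2 := node (-s * c - w / 2 * (2 * c ^ 2 - 1)) (-s / 2 + w / 2 * c) (by
    rw [← hcos, hS]; ring_nf; simp only [hw, hc2, hc4, hc6]; ring)
  -- The absolute values of the three interpolation coefficients sum to 1, which is why the bound M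
  -- passes to the polar form unchanged.
  have hsum : 16 / 9 * ((s / 2 + w / 2 * c) ^ 2 * (-s / 2 + w / 2 * c) ^ 2)
      + 16 / 9 * (s ^ 2 * (-s / 2 + w / 2 * c) ^ 2)
      + 16 / 9 * (s ^ 2 * (s / 2 + w / 2 * c) ^ 2) = 1 := by
    have hw4 : w ^ 4 = 9 := by rw [show w ^ 4 = (w ^ 2) ^ 2 by ring, hw]; norm_num
    ring_nf; simp only [hw, hw4, hc2, hc4]; ring
  have w0 : 0 ≤ 16 / 9 * ((s / 2 + w / 2 * c) ^ 2 * (-s / 2 + w / 2 * c) ^ 2) := by positivity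
  have w1 : 0 ≤ 16 / 9 * (s ^ 2 * (-s / 2 + w / 2 * c) ^ 2) := by positivity
  have w2 : 0 ≤ 16 / 9 * (s ^ 2 * (s / 2 + w / 2 * c) ^ 2) := by positivity
  have hbound : |S ^ 3 * c1| ≤ M * S ^ 3 := by
    rw [key]
    generalize 16 / 9 * ((s / 2 + w / 2 * c) ^ 2 * (-s / 2 + w / 2 * c) ^ 2) = W0 at *
    generalize 16 / 9 * (s ^ 2 * (-s / 2 + w / 2 * c) ^ 2) = W1 at *
    generalize 16 / 9 * (s ^ 2 * (s / 2 + w / 2 * c) ^ 2) = W2 at *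
    calc _ ≤ |W0 * P (2 * s * c) s|
            + |W1 * P (s * c - w / 2 * (2 * c ^ 2 - 1)) (s / 2 + w / 2 * c)|
            + |W2 * P (-s * c - w / 2 * (2 * c ^ 2 - 1)) (-s / 2 + w / 2 * c)| :=
          (abs_add_le _ _).trans (add_le_add_left (abs_sub _ _) _)
      _ ≤ W0 * (M * S ^ 3) + W1 * (M * S ^ 3) + W2 * (M * S ^ 3) := by
          rw [abs_mul, abs_mul, abs_mul, abs_of_nonneg w0, abs_of_nonneg w1, abs_of_nonneg w2]
          gcongr
      _ = M * S ^ 3 := by rw [← add_mul, ← add_mul, hsum, one_mul]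
  have hS3 : 0 < S ^ 3 := by positivity
  rw [abs_mul, abs_of_pos hS3, mul_comm] at hbound
  exact le_of_mul_le_mul_right hbound hS3

/-- A binary cubic form `P` with `|P| ≤ M q^{3/2}`, for a positive semidefinite quadratic form `q`,
has its polar form bounded accordingly. -/
lemma abs_cubic_polar_le {c0 c1 c2 c3 q0 q1 q2 M : ℝ} (hM : 0 ≤ M)
    (hq : ∀ a b : ℝ, 0 ≤ q0 * a ^ 2 + 2 * q1 * a * b + q2 * b ^ 2)
    (h : ∀ a b : ℝ, |c0 * a ^ 3 + 3 * c1 * a ^ 2 * b + 3 * c2 * a * b ^ 2 + c3 * b ^ 3| ≤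
      M * √(q0 * a ^ 2 + 2 * q1 * a * b + q2 * b ^ 2) ^ 3) : |c1| ≤ M * (q0 * √q2) := by
  have h0 : 0 ≤ q0 := by simpa using hq 1 0
  have h2 : 0 ≤ q2 := by simpa using hq 0 1
  have h1 : q1 ^ 2 ≤ q0 * q2 := by
    have := discrim_le_zero (a := q0) (b := 2 * q1) (c := q2) fun x => by
      have := hq x 1; nlinarith
    rw [discrim] at this; nlinarith
  -- Adding ε to both diagonal entries makes the quadratic form definite; rescaling the two
  -- variables then makes its diagonal 1, with off-diagonal coefficient ρ in (-1, 1).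
  have main : ∀ ε : ℝ, 0 < ε → |c1| ≤ M * ((q0 + ε) * √(q2 + ε)) := by
    intro ε hε
    have p0 : 0 < q0 + ε := by linarith
    have p2 : 0 < q2 + ε := by linarith
    obtain ⟨x, hx, hx0⟩ : ∃ x, 0 < x ∧ x ^ 2 = q0 + ε :=
      ⟨_, Real.sqrt_pos.2 p0, Real.sq_sqrt p0.le⟩
    obtain ⟨y, hy, hy0⟩ : ∃ y, 0 < y ∧ y ^ 2 = q2 + ε :=
      ⟨_, Real.sqrt_pos.2 p2, Real.sq_sqrt p2.le⟩
    rw [← hx0, ← hy0, Real.sqrt_sq hy.le]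
    have hρ : |q1 / (x * y)| < 1 := by
      rw [abs_div, abs_of_pos (mul_pos hx hy), div_lt_one (mul_pos hx hy)]
      refine abs_lt_of_sq_lt_sq ?_ (mul_pos hx hy).le
      rw [mul_pow, hx0, hy0]; nlinarith
    have := abs_cubic_polar_le_of_unit (c0 := c0 / x ^ 3) (c1 := c1 / (x ^ 2 * y))
      (c2 := c2 / (x * y ^ 2)) (c3 := c3 / y ^ 3) (M := M) hρ fun a b => by
        have h3 := h (a / x) (b / y)
        have e1 : c0 / x ^ 3 * a ^ 3 + 3 * (c1 / (x ^ 2 * y)) * a ^ 2 * b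
            + 3 * (c2 / (x * y ^ 2)) * a * b ^ 2 + c3 / y ^ 3 * b ^ 3
            = c0 * (a / x) ^ 3 + 3 * c1 * (a / x) ^ 2 * (b / y) + 3 * c2 * (a / x) * (b / y) ^ 2
              + c3 * (b / y) ^ 3 := by field_simp
        rw [e1]
        refine h3.trans (mul_le_mul_of_nonneg_left
          (pow_le_pow_left₀ (Real.sqrt_nonneg _) (Real.sqrt_le_sqrt ?_) 3) hM)
        have e2 : a ^ 2 + 2 * (q1 / (x * y)) * a * b + b ^ 2
          = x ^ 2 * (a / x) ^ 2 + 2 * q1 * (a / x) * (b / y) + y ^ 2 * (b / y) ^ 2 := by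
            field_simp
        rw [e2, hx0, hy0]
        nlinarith [sq_nonneg (a / x), sq_nonneg (b / y)]
    rw [abs_div, abs_of_pos (by positivity : 0 < x ^ 2 * y), div_le_iff₀ (by positivity)] at this
    exact this
  have lim : Filter.Tendsto (fun ε : ℝ => M * ((q0 + ε) * √(q2 + ε))) (nhdsWithin 0 (Set.Ioi 0))
      (nhds (M * (q0 * √q2))) := by
    have : Continuous fun ε : ℝ => M * ((q0 + ε) * √(q2 + ε)) := by fun_prop
    simpa using (this.tendsto 0).mono_left nhdsWithin_le_nhds
  exact ge_of_tendsto lim (by filter_upwards [self_mem_nhdsWithin] with ε hε using main ε hε)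

end CubicForms

/-! ### Second and third derivatives along lines -/

section Derivatives

variable {p : ℕ} {D : Set (Vec p)} {f : Vec p → ℝ} {x : Vec p}

/-- The second derivative of `f` at `x`, as a bilinear form. -/
noncomputable def hessForm (f : Vec p → ℝ) (x u v : Vec p) : ℝ :=
  fderiv ℝ (fderiv ℝ f) x u v

/-- The third derivative of `f` at `x`, as a trilinear form. -/
noncomputable def thirdForm (f : Vec p → ℝ) (x u v w : Vec p) : ℝ :=
  fderiv ℝ (fderiv ℝ (fderiv ℝ f)) x u v w

lemma inner_gradient (f : Vec p → ℝ) (x v : Vec p) :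
    inner ℝ (gradient f x) v = fderiv ℝ f x v := by
  rw [gradient, InnerProductSpace.toDual_symm_apply]

lemma contDiffAt_fderiv (hf : ContDiffAt ℝ 3 f x) : ContDiffAt ℝ 2 (fderiv ℝ f) x :=
  hf.fderiv_right (by norm_num)

lemma contDiffAt_fderiv_fderiv (hf : ContDiffAt ℝ 3 f x) :
    ContDiffAt ℝ 1 (fderiv ℝ (fderiv ℝ f)) x :=
  (contDiffAt_fderiv hf).fderiv_right (by norm_num)

lemma inner_hessian (hf : ContDiffAt ℝ 3 f x) (u v : Vec p) :
    inner ℝ (hessian f x u) v = hessForm f x u v := by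
  have h1 : DifferentiableAt ℝ (fderiv ℝ f) x :=
    (contDiffAt_fderiv hf).differentiableAt (by norm_num)
  let J : (Vec p →L[ℝ] ℝ) →L[ℝ] Vec p := LinearMap.toContinuousLinearMap
    { toFun := (InnerProductSpace.toDual ℝ (Vec p)).symm
      map_add' := map_add _
      map_smul' := fun c u => by simp }
  have h2 : HasFDerivAt (gradient f) (J.comp (fderiv ℝ (fderiv ℝ f) x)) x :=
    J.hasFDerivAt.comp x h1.hasFDerivAt
  rw [hessian, h2.fderiv, hessForm]
  exact InnerProductSpace.toDual_symm_apply

lemma hessForm_symm (hf : ContDiffAt ℝ 3 f x) (u v : Vec p) :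
    hessForm f x u v = hessForm f x v u :=
  (hf.isSymmSndFDerivAt (by simp; norm_num)) u v

lemma thirdForm_swap_left (hf : ContDiffAt ℝ 3 f x) (u v w : Vec p) :
    thirdForm f x u v w = thirdForm f x v u w :=
  congrArg (fun L : Vec p →L[ℝ] ℝ => L w)
    ((contDiffAt_fderiv hf).isSymmSndFDerivAt (by simp) u v)

lemma hasDerivAt_line (x h : Vec p) (t : ℝ) :
    HasDerivAt (fun s : ℝ => x + s • h) h t := by
  simpa using ((hasDerivAt_id t).smul_const h).const_add x

lemma hasDerivAt_fderiv_line {h : Vec p} {t : ℝ} (hf : ContDiffAt ℝ 3 f (x + t • h))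
    (v : Vec p) :
    HasDerivAt (fun s : ℝ => fderiv ℝ f (x + s • h) v) (hessForm f (x + t • h) h v) t := by
  have h1 : DifferentiableAt ℝ (fderiv ℝ f) (x + t • h) :=
    (contDiffAt_fderiv hf).differentiableAt (by norm_num)
  have h2 := h1.hasFDerivAt.comp_hasDerivAt t (hasDerivAt_line x h t)
  simpa [hessForm] using h2.clm_apply (hasDerivAt_const t v)

lemma hasDerivAt_hessForm_line {h : Vec p} {t : ℝ} (hf : ContDiffAt ℝ 3 f (x + t • h))
    (v w : Vec p) :
    HasDerivAt (fun s : ℝ => hessForm f (x + s • h) v w) (thirdForm f (x + t • h) h v w) t := by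
  have h1 : DifferentiableAt ℝ (fderiv ℝ (fderiv ℝ f)) (x + t • h) :=
    (contDiffAt_fderiv_fderiv hf).differentiableAt (by norm_num)
  have h2 : HasDerivAt (fun s : ℝ => fderiv ℝ (fderiv ℝ f) (x + s • h))
      (fderiv ℝ (fderiv ℝ (fderiv ℝ f)) (x + t • h) h) t :=
    HasFDerivAt.comp_hasDerivAt (E := Vec p →L[ℝ] Vec p →L[ℝ] ℝ)
      (f := fun s : ℝ => x + s • h) t h1.hasFDerivAt
      (hasDerivAt_line x h t)
  simpa [hessForm, thirdForm] using
    (h2.clm_apply (hasDerivAt_const t v)).clm_apply (hasDerivAt_const t w)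

/-- Differentiate the symmetry of the Hessian, valid near x, in the direction u. -/
lemma thirdForm_swap_right (hf : ContDiffAt ℝ 3 f x) (u v w : Vec p) :
    thirdForm f x u v w = thirdForm f x u w v := by
  have hf' : ContDiffAt ℝ 3 f (x + (0 : ℝ) • u) := by simpa using hf
  have h1 := hasDerivAt_hessForm_line hf' v w
  have h2 := hasDerivAt_hessForm_line hf' w v
  have h3 : (fun s : ℝ => hessForm f (x + s • u) v w) =ᶠ[nhds 0]
      fun s : ℝ => hessForm f (x + s • u) w v := by
    have hc : Filter.Tendsto (fun s : ℝ => x + s • u) (nhds 0) (nhds x) := by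
      have : Continuous fun s : ℝ => x + s • u := by fun_prop
      simpa using this.tendsto 0
    filter_upwards [hc.eventually (hf.eventually (by simp))] with s hs
      using hessForm_symm hs v w
  simpa using (h1.congr_of_eventuallyEq h3.symm).unique h2

namespace StandardSelfConcordant

lemma contDiffAt (hsc : StandardSelfConcordant D f) (hx : x ∈ D) : ContDiffAt ℝ 3 f x :=
  hsc.contDiffOn.contDiffAt (hsc.isOpen.mem_nhds hx)

lemma isOpen_line (hsc : StandardSelfConcordant D f) (x v : Vec p) :
    IsOpen {t : ℝ | x + t • v ∈ D} :=
  hsc.isOpen.preimage (by fun_prop)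

lemma deriv_line (hsc : StandardSelfConcordant D f) (v : Vec p) {t : ℝ} (ht : x + t • v ∈ D) :
    deriv (fun s : ℝ => f (x + s • v)) t = fderiv ℝ f (x + t • v) v := by
  have h1 : DifferentiableAt ℝ f (x + t • v) := (hsc.contDiffAt ht).differentiableAt (by norm_num)
  exact (h1.hasFDerivAt.comp_hasDerivAt t (hasDerivAt_line x v t)).deriv

lemma deriv_deriv_line (hsc : StandardSelfConcordant D f) (v : Vec p) {t : ℝ}
    (ht : x + t • v ∈ D) :
    deriv (deriv fun s : ℝ => f (x + s • v)) t = hessForm f (x + t • v) v v := by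
  have : deriv (fun s : ℝ => f (x + s • v)) =ᶠ[nhds t] fun s => fderiv ℝ f (x + s • v) v := by
    filter_upwards [(hsc.isOpen_line x v).mem_nhds ht] with s hs using hsc.deriv_line v hs
  rw [this.deriv_eq, (hasDerivAt_fderiv_line (hsc.contDiffAt ht) v).deriv]

lemma deriv_deriv_deriv_line (hsc : StandardSelfConcordant D f) (v : Vec p) {t : ℝ}
    (ht : x + t • v ∈ D) :
    deriv (deriv (deriv fun s : ℝ => f (x + s • v))) t = thirdForm f (x + t • v) v v v := by
  have : deriv (deriv fun s : ℝ => f (x + s • v)) =ᶠ[nhds t]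
      fun s => hessForm f (x + s • v) v v := by
    filter_upwards [(hsc.isOpen_line x v).mem_nhds ht] with s hs using hsc.deriv_deriv_line v hs
  rw [this.deriv_eq, (hasDerivAt_hessForm_line (hsc.contDiffAt ht) v v).deriv]

lemma hessForm_nonneg (hsc : StandardSelfConcordant D f) (hx : x ∈ D) (v : Vec p) :
    0 ≤ hessForm f x v v := by
  have h0 : x + (0 : ℝ) • v ∈ D := by simpa using hx
  have hline := hsc.onLines x hx v
  have hmono : MonotoneOn (deriv fun s : ℝ => f (x + s • v)) {t : ℝ | x + t • v ∈ D} :=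
    hline.convexOn.monotoneOn_deriv fun t ht =>
      (((hsc.contDiffAt ht).differentiableAt (by norm_num)).hasFDerivAt.comp_hasDerivAt t
        (hasDerivAt_line x v t)).differentiableAt
  have := hmono.derivWithin_nonneg (x := 0)
  rw [derivWithin_of_isOpen hline.isOpen h0, hsc.deriv_deriv_line v h0] at this
  simpa using this

lemma abs_thirdForm_diag_le (hsc : StandardSelfConcordant D f) (hx : x ∈ D) (v : Vec p) :
    |thirdForm f x v v v| ≤ 2 * √(hessForm f x v v) ^ 3 := by
  have h0 : x + (0 : ℝ) • v ∈ D := by simpa using hx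
  have := (hsc.onLines x hx v).bound 0 h0
  rw [iteratedDeriv_eq_iterate, iteratedDeriv_eq_iterate] at this
  simp only [Function.iterate_succ, Function.iterate_zero, Function.comp_apply, id] at this
  rw [hsc.deriv_deriv_line v h0, hsc.deriv_deriv_deriv_line v h0] at this
  simp only [zero_smul, add_zero] at this
  convert this using 2
  rw [Real.sqrt_eq_rpow, ← Real.rpow_mul_natCast (hsc.hessForm_nonneg hx v)]
  norm_num

/-- In the plane of v and h, the third derivative is a binary cubic and the Hessian a semidefinite
quadratic form; `abs_cubic_polar_le` turns the diagonal bound into this mixed one. -/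
lemma abs_thirdForm_le (hsc : StandardSelfConcordant D f) (hx : x ∈ D) (h v : Vec p) :
    |thirdForm f x h v v| ≤ 2 * (hessForm f x v v * √(hessForm f x h h)) := by
  have hf := hsc.contDiffAt hx
  have hq : ∀ a b : ℝ, hessForm f x v v * a ^ 2 + 2 * hessForm f x v h * a * b
      + hessForm f x h h * b ^ 2 = hessForm f x (a • v + b • h) (a • v + b • h) := by
    intro a b
    have := hessForm_symm hf h v
    simp only [hessForm, map_add, map_smul, add_apply, smul_apply, smul_eq_mul] at this ⊢
    rw [this]; ring
  have hc : ∀ a b : ℝ, thirdForm f x v v v * a ^ 3 + 3 * thirdForm f x h v v * a ^ 2 * b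
      + 3 * thirdForm f x v h h * a * b ^ 2 + thirdForm f x h h h * b ^ 3
      = thirdForm f x (a • v + b • h) (a • v + b • h) (a • v + b • h) := by
    intro a b
    have e1 := thirdForm_swap_left hf v h v
    have e2 := thirdForm_swap_right hf v v h
    have e3 := thirdForm_swap_left hf v h h
    have e4 := thirdForm_swap_right hf h v h
    simp only [thirdForm, map_add, map_smul, add_apply, smul_apply, smul_eq_mul]
      at e1 e2 e3 e4 ⊢
    rw [e2, e1, ← e4, ← e3]; ring
  refine abs_cubic_polar_le (c0 := thirdForm f x v v v) (c2 := thirdForm f x v h h)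
    (c3 := thirdForm f x h h h) (q1 := hessForm f x v h) (by norm_num) ?_ ?_
  · intro a b; rw [hq]; exact hsc.hessForm_nonneg hx _
  · intro a b; rw [hq, hc]; exact hsc.abs_thirdForm_diag_le hx _

end StandardSelfConcordant

end Derivatives

/-! ### Variation of the Hessian along a segment -/

section HessianComparison

variable {p : ℕ} {D : Set (Vec p)} {f : Vec p → ℝ} {x : Vec p}

lemma monotoneOn_Icc_of_hasDerivAt {φ φ' : ℝ → ℝ}
    (h : ∀ t ∈ Set.Icc (0 : ℝ) 1, HasDerivAt φ (φ' t) t)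
    (h' : ∀ t ∈ Set.Icc (0 : ℝ) 1, 0 ≤ φ' t) : MonotoneOn φ (Set.Icc 0 1) := by
  refine monotoneOn_of_deriv_nonneg (convex_Icc 0 1)
    (fun t ht => (h t ht).continuousAt.continuousWithinAt)
    (fun t ht => (h t (interior_subset ht)).differentiableAt.differentiableWithinAt) fun t ht => ?_
  rw [(h t (interior_subset ht)).deriv]
  exact h' t (interior_subset ht)

namespace StandardSelfConcordant

/-- If q(s) is the second derivative along the segment, |q'| ≤ 2q^(3/2) says that q^(-1/2) decreases
at rate at most 1. -/
lemma sqrt_hessForm_line_le (hsc : StandardSelfConcordant D f) {h : Vec p}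
    (hseg : ∀ t ∈ Set.Icc (0 : ℝ) 1, x + t • h ∈ D) {r : ℝ}
    (hr : √(hessForm f x h h) < r) (hr1 : r < 1) {t : ℝ} (ht : t ∈ Set.Icc (0 : ℝ) 1) :
    √(hessForm f (x + t • h) h h) ≤ r / (1 - t * r) := by
  have h0mem : (0 : ℝ) ∈ Set.Icc (0 : ℝ) 1 := by simp
  have hr0 : 0 < r := (Real.sqrt_nonneg _).trans_lt hr
  set q : ℝ → ℝ := fun s => hessForm f (x + s • h) h h with hq
  have hq0 : q 0 = hessForm f x h h := by simp [hq]
  have hqn : ∀ s ∈ Set.Icc (0 : ℝ) 1, 0 ≤ q s := fun s hs => hsc.hessForm_nonneg (hseg s hs) h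
  -- The shift by η keeps q + η positive where q may vanish, and makes √(q + η) start exactly at r.
  -- It is positive because r is strictly larger than the local norm of h.
  set η := r ^ 2 - q 0 with hη
  have hηpos : 0 < η := by
    have := Real.lt_sq_of_sqrt_lt (hq0 ▸ hr)
    linarith
  have hpos : ∀ s ∈ Set.Icc (0 : ℝ) 1, 0 < q s + η := fun s hs => by
    have := hqn s hs; linarith
  have hmono : MonotoneOn (fun s => (√(q s + η))⁻¹ + s) (Set.Icc 0 1) := by
    refine monotoneOn_Icc_of_hasDerivAt
      (φ' := fun s => -(thirdForm f (x + s • h) h h h / (2 * √(q s + η))) / √(q s + η) ^ 2 + 1)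
      (fun s hs => ?_) fun s hs => ?_
    · have h1 : HasDerivAt q (thirdForm f (x + s • h) h h h) s :=
        hasDerivAt_hessForm_line (hsc.contDiffAt (hseg s hs)) h h
      exact (((h1.add_const η).sqrt (hpos s hs).ne').inv
        (Real.sqrt_pos.2 (hpos s hs)).ne').add (hasDerivAt_id s)
    · have hS : 0 < √(q s + η) := Real.sqrt_pos.2 (hpos s hs)
      have h1 := (le_abs_self _).trans (hsc.abs_thirdForm_diag_le (hseg s hs) h)
      have h2 : √(q s) ^ 3 ≤ √(q s + η) ^ 3 :=
        pow_le_pow_left₀ (Real.sqrt_nonneg _) (Real.sqrt_le_sqrt (by linarith)) 3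
      have h3 : thirdForm f (x + s • h) h h h / (2 * √(q s + η)) / √(q s + η) ^ 2 ≤ 1 := by
        rw [div_div, div_le_one (by positivity)]
        calc _ ≤ 2 * √(q s) ^ 3 := h1
          _ ≤ 2 * √(q s + η) ^ 3 := by linarith
          _ = _ := by ring
      rw [neg_div]; linarith
  have h1 := hmono h0mem ht ht.1
  have h2 : √(q 0 + η) = r := by rw [hη, add_sub_cancel, Real.sqrt_sq hr0.le]
  simp only [h2, add_zero] at h1
  have htr : 0 < 1 - t * r := by nlinarith [ht.1, ht.2]
  have hS : 0 < √(q t + η) := Real.sqrt_pos.2 (hpos t ht)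
  calc √(q t) ≤ √(q t + η) := Real.sqrt_le_sqrt (by linarith)
    _ ≤ r / (1 - t * r) := by
      rw [← inv_inv (√(q t + η)), ← inv_inv (r / (1 - t * r)), inv_div]
      refine inv_anti₀ (by positivity) ?_
      rw [sub_div, mul_div_assoc, div_self hr0.ne', one_div]
      linarith

/-- For g(s) = D²f(x+sh)[v,v], the mixed third-derivative bound gives |g'|(1 - sr) ≤ 2rg. Hence
g/(1-sr)² is nondecreasing and g(1-sr)² is nonincreasing. -/
lemma hessForm_line_aux (hsc : StandardSelfConcordant D f) {h : Vec p}
    (hseg : ∀ t ∈ Set.Icc (0 : ℝ) 1, x + t • h ∈ D) {r : ℝ}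
    (hr : √(hessForm f x h h) < r) (hr1 : r < 1) {t : ℝ} (ht : t ∈ Set.Icc (0 : ℝ) 1)
    (v : Vec p) :
    (1 - t * r) ^ 2 * hessForm f x v v ≤ hessForm f (x + t • h) v v ∧
      (1 - t * r) ^ 2 * hessForm f (x + t • h) v v ≤ hessForm f x v v := by
  have h0mem : (0 : ℝ) ∈ Set.Icc (0 : ℝ) 1 := by simp
  have hr0 : 0 < r := (Real.sqrt_nonneg _).trans_lt hr
  have hpos : ∀ s ∈ Set.Icc (0 : ℝ) 1, 0 < 1 - s * r := fun s hs => by nlinarith [hs.1, hs.2]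
  set g : ℝ → ℝ := fun s => hessForm f (x + s • h) v v with hg
  set g' : ℝ → ℝ := fun s => thirdForm f (x + s • h) h v v with hg'
  have hg0 : g 0 = hessForm f x v v := by simp [hg]
  have hd : ∀ s ∈ Set.Icc (0 : ℝ) 1, HasDerivAt g (g' s) s := fun s hs =>
    hasDerivAt_hessForm_line (hsc.contDiffAt (hseg s hs)) v v
  have hgn : ∀ s ∈ Set.Icc (0 : ℝ) 1, 0 ≤ g s := fun s hs => hsc.hessForm_nonneg (hseg s hs) v
  have hb : ∀ s ∈ Set.Icc (0 : ℝ) 1, |g' s| * (1 - s * r) ≤ 2 * r * g s := fun s hs => by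
    have h1 := hsc.abs_thirdForm_le (hseg s hs) h v
    have h2 := hsc.sqrt_hessForm_line_le hseg hr hr1 hs
    rw [← le_div_iff₀ (hpos s hs)]
    calc |g' s| ≤ 2 * (g s * √(hessForm f (x + s • h) h h)) := h1
      _ ≤ 2 * (g s * (r / (1 - s * r))) := by have := hgn s hs; gcongr
      _ = _ := by ring
  have hlin : ∀ s : ℝ, HasDerivAt (fun s => 1 - s * r) (-r) s := fun s => by
    simpa using ((hasDerivAt_id s).mul_const r).const_sub 1
  constructor
  · have hmono : MonotoneOn (fun s => g s * ((1 - s * r)⁻¹) ^ 2) (Set.Icc 0 1) := by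
      refine monotoneOn_Icc_of_hasDerivAt (fun s hs =>
        (hd s hs).mul (((hlin s).inv (hpos s hs).ne').pow 2)) fun s hs => ?_
      have h1 := hpos s hs
      have h2 := (neg_abs_le (g' s))
      have h3 := hb s hs
      have : g' s * ((1 - s * r)⁻¹) ^ 2 + g s * (((2 : ℕ) : ℝ) * (1 - s * r)⁻¹ ^ (2 - 1)
          * (-(-r) / (1 - s * r) ^ 2)) = (g' s * (1 - s * r) + 2 * r * g s) / (1 - s * r) ^ 3 := by
        simp only [Nat.add_one_sub_one, pow_one, Nat.cast_ofNat]
        field_simp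
      rw [Pi.inv_apply, this]
      apply div_nonneg _ (by positivity)
      nlinarith
    have := hmono h0mem ht ht.1
    simp only [zero_mul, sub_zero, inv_one, one_pow, mul_one, hg0] at this
    have h1 := hpos t ht
    calc _ ≤ (1 - t * r) ^ 2 * (g t * (1 - t * r)⁻¹ ^ 2) := by gcongr
      _ = g t := by field_simp
  · have hmono : MonotoneOn (fun s => -(g s * (1 - s * r) ^ 2)) (Set.Icc 0 1) := by
      refine monotoneOn_Icc_of_hasDerivAt (fun s hs =>
        ((hd s hs).mul ((hlin s).pow 2)).neg) fun s hs => ?_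
      have h1 := hpos s hs
      have h2 := (le_abs_self (g' s))
      have h3 := hb s hs
      have h4 : 0 ≤ (2 * r * g s - g' s * (1 - s * r)) * (1 - s * r) :=
        mul_nonneg (by nlinarith) h1.le
      simp only [Nat.cast_ofNat, Nat.add_one_sub_one, pow_one, Pi.pow_apply]
      linarith
    have := hmono h0mem ht ht.1
    simp only [zero_mul, sub_zero, one_pow, mul_one, hg0] at this
    linarith

/-- Along a segment of length `r < 1` in the local norm, the Hessian of a self-concordant function
changes by a factor of at most `(1 - t r)⁻²`. -/
lemma hessForm_line_bounds (hsc : StandardSelfConcordant D f) {h : Vec p}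
    (hseg : ∀ t ∈ Set.Icc (0 : ℝ) 1, x + t • h ∈ D) {r : ℝ}
    (hr : √(hessForm f x h h) ≤ r) (hr1 : r < 1) {t : ℝ} (ht : t ∈ Set.Icc (0 : ℝ) 1)
    (v : Vec p) :
    (1 - t * r) ^ 2 * hessForm f x v v ≤ hessForm f (x + t • h) v v ∧
      (1 - t * r) ^ 2 * hessForm f (x + t • h) v v ≤ hessForm f x v v := by
  have lim : ∀ c : ℝ, Filter.Tendsto (fun s : ℝ => (1 - t * s) ^ 2 * c)
      (nhdsWithin r (Set.Ioi r)) (nhds ((1 - t * r) ^ 2 * c)) := fun c => by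
    have : Continuous fun s : ℝ => (1 - t * s) ^ 2 * c := by fun_prop
    exact (this.tendsto r).mono_left nhdsWithin_le_nhds
  have hev : ∀ᶠ s in nhdsWithin r (Set.Ioi r), r < s ∧ s < 1 :=
    Ioo_mem_nhdsGT hr1
  constructor
  · exact le_of_tendsto (lim _) (hev.mono fun s hs =>
      (hsc.hessForm_line_aux hseg (hr.trans_lt hs.1) hs.2 ht v).1)
  · exact le_of_tendsto (lim _) (hev.mono fun s hs =>
      (hsc.hessForm_line_aux hseg (hr.trans_lt hs.1) hs.2 ht v).2)

end StandardSelfConcordant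

end HessianComparison

/-! ### Weighted norms and their duals -/

section WeightedNorms

variable {p : ℕ} {A : Op p}

lemma weightedNorm_nonneg (A : Op p) (u : Vec p) : 0 ≤ weightedNorm A u := Real.sqrt_nonneg _

lemma dualNorm_nonneg (A : Op p) (u : Vec p) : 0 ≤ dualNorm A u := Real.sqrt_nonneg _

namespace IsPosDef

lemma inner_comm (hA : IsPosDef A) (u v : Vec p) : inner ℝ (A u) v = inner ℝ (A v) u := by
  have : inner ℝ (A u) v = inner ℝ u (A v) := hA.1 u v
  rw [this, real_inner_comm]

lemma inner_self_nonneg (hA : IsPosDef A) (u : Vec p) : 0 ≤ inner ℝ (A u) u := by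
  rcases eq_or_ne u 0 with rfl | hu
  · simp
  · exact (hA.2 u hu).le

lemma weightedNorm_sq (hA : IsPosDef A) (u : Vec p) : weightedNorm A u ^ 2 = inner ℝ (A u) u :=
  Real.sq_sqrt (hA.inner_self_nonneg u)

lemma eq_zero_of_weightedNorm_eq_zero (hA : IsPosDef A) {u : Vec p}
    (h : weightedNorm A u = 0) : u = 0 := by
  by_contra hu
  have h1 := hA.2 u hu
  rw [← hA.weightedNorm_sq, h] at h1
  simp at h1

lemma weightedNorm_smul (A : Op p) (c : ℝ) (u : Vec p) :
    weightedNorm A (c • u) = |c| * weightedNorm A u := by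
  rw [weightedNorm, map_smul, real_inner_smul_left, real_inner_smul_right, ← mul_assoc,
    Real.sqrt_mul (mul_self_nonneg c), Real.sqrt_mul_self_eq_abs, weightedNorm]

lemma apply_inverse (hA : IsPosDef A) (v : Vec p) : A (A.inverse v) = v := by
  have hinj : Function.Injective (A : Vec p →ₗ[ℝ] Vec p) := by
    rw [injective_iff_map_eq_zero]
    intro u hu
    by_contra h0
    have := hA.2 u h0
    rw [show A u = 0 from hu, inner_zero_left] at this
    exact this.false
  set e : Vec p ≃L[ℝ] Vec p := (LinearEquiv.ofInjectiveEndo _ hinj).toContinuousLinearEquiv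
  have he : (e : Op p) = A := by ext1 u; rfl
  rw [← he, ContinuousLinearMap.inverse_equiv]
  simp

lemma dualNorm_sq (hA : IsPosDef A) (v : Vec p) :
    dualNorm A v ^ 2 = inner ℝ (A.inverse v) v := by
  refine Real.sq_sqrt ?_
  have := hA.inner_self_nonneg (A.inverse v)
  rwa [hA.apply_inverse, real_inner_comm] at this

lemma dualNorm_eq (hA : IsPosDef A) (v : Vec p) :
    dualNorm A v = weightedNorm A (A.inverse v) := by
  rw [dualNorm, weightedNorm, hA.apply_inverse, real_inner_comm]

/-- A symmetric form that is bounded by `c` on the diagonal is bounded by `c`. -/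
lemma abs_inner_le_of_diag (hA : IsPosDef A) {T : Op p}
    (hT : ∀ u v : Vec p, inner ℝ (T u) v = inner ℝ (T v) u) {c : ℝ}
    (h : ∀ u, |inner ℝ (T u) u| ≤ c * weightedNorm A u ^ 2) (u v : Vec p) :
    |inner ℝ (T u) v| ≤ c * (weightedNorm A u * weightedNorm A v) := by
  have pol : ∀ u v : Vec p, |inner ℝ (T u) v| ≤
      c * (weightedNorm A u ^ 2 + weightedNorm A v ^ 2) / 2 := by
    intro u v
    have h1 := h (u + v)
    have h2 := h (u - v)
    rw [hA.weightedNorm_sq] at h1 h2 ⊢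
    rw [hA.weightedNorm_sq]
    have e1 := hT u v
    have e2 := hA.inner_comm u v
    simp only [map_add, map_sub, inner_add_left, inner_add_right, inner_sub_left,
      inner_sub_right] at h1 h2
    rw [abs_le] at h1 h2 ⊢
    constructor <;> nlinarith
  rcases (weightedNorm_nonneg A u).eq_or_lt with hu | hu
  · rw [hA.eq_zero_of_weightedNorm_eq_zero hu.symm]; simp [weightedNorm]
  rcases (weightedNorm_nonneg A v).eq_or_lt with hv | hv
  · rw [hA.eq_zero_of_weightedNorm_eq_zero hv.symm]; simp [weightedNorm]
  -- Rescaling u and v to equal norms turns the arithmetic mean of the squared norms in `pol` into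
  -- their product.
  have h3 := pol (weightedNorm A v • u) (weightedNorm A u • v)
  rw [weightedNorm_smul, weightedNorm_smul, map_smul, real_inner_smul_left,
    real_inner_smul_right, abs_mul, abs_mul, abs_of_pos hu, abs_of_pos hv] at h3
  have huv := mul_pos hu hv
  refine le_of_mul_le_mul_left ?_ huv
  nlinarith

lemma inner_le (hA : IsPosDef A) (u v : Vec p) :
    inner ℝ (A u) v ≤ weightedNorm A u * weightedNorm A v := by
  have := hA.abs_inner_le_of_diag (T := A) hA.inner_comm (c := 1)
    (fun u => by rw [hA.weightedNorm_sq, one_mul, abs_of_nonneg (hA.inner_self_nonneg u)]) u v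
  rw [one_mul] at this
  exact (le_abs_self _).trans this

lemma inner_le_dualNorm (hA : IsPosDef A) (v u : Vec p) :
    inner ℝ v u ≤ dualNorm A v * weightedNorm A u := by
  have := hA.inner_le (A.inverse v) u
  rwa [hA.apply_inverse, ← hA.dualNorm_eq] at this

lemma dualNorm_le (hA : IsPosDef A) {v : Vec p} {c : ℝ} (hc : 0 ≤ c)
    (h : ∀ u, inner ℝ v u ≤ c * weightedNorm A u) : dualNorm A v ≤ c := by
  have h1 := h (A.inverse v)
  rw [real_inner_comm, ← hA.dualNorm_sq, ← hA.dualNorm_eq] at h1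
  by_contra! hlt
  nlinarith [dualNorm_nonneg A v]

/-- Two points `d`, `w` with `⟨b - A d, d - w⟩ ≥ 0` satisfy `‖d‖² ≤ ‖w‖² + ‖b‖_*²`. -/
lemma weightedNorm_sq_le_of_inner_nonneg (hA : IsPosDef A) {b d w : Vec p}
    (h : 0 ≤ inner ℝ (b - A d) (d - w)) :
    weightedNorm A d ^ 2 ≤ weightedNorm A w ^ 2 + dualNorm A b ^ 2 := by
  obtain ⟨q, hq⟩ : ∃ q, q = A.inverse b := ⟨_, rfl⟩
  have hb : b = A q := by rw [hq, hA.apply_inverse]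
  rw [hA.dualNorm_eq, ← hq, hA.weightedNorm_sq, hA.weightedNorm_sq, hA.weightedNorm_sq]
  have h1 := hA.inner_self_nonneg (d - w - q)
  rw [hb] at h
  have e1 := hA.inner_comm d w
  have e2 := hA.inner_comm d q
  have e3 := hA.inner_comm w q
  simp only [map_sub, inner_sub_left, inner_sub_right] at h h1
  linarith

end IsPosDef

end WeightedNorms

/-! ### The one-step inequality for the decrement -/

section OneStep

variable {p : ℕ} {D : Set (Vec p)} {f : Vec p → ℝ}

lemma subdifferential_mono {DR : Set (Vec p)} {R : Vec p → ℝ} {z z' s s' : Vec p}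
    (hs : s ∈ subdifferential DR R z) (hs' : s' ∈ subdifferential DR R z') :
    0 ≤ inner ℝ (s' - s) (z' - z) := by
  have h1 := hs.2 z' hs'.1
  have h2 := hs'.2 z hs.1
  have : inner ℝ s' (z - z') = - inner ℝ s' (z' - z) := by rw [← inner_neg_right, neg_sub]
  rw [inner_sub_left]
  linarith

/-- The positive definite operator `A` is a relative approximation of the Hessian of `f` at `x`. -/
structure IsHessianApprox (f : Vec p → ℝ) (x : Vec p) (A : Op p) (δ : ℝ) : Prop where
  posDef : IsPosDef A
  nonneg : 0 ≤ δ
  lt_one : δ < 1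
  lower : ∀ u, (1 - δ) ^ 2 * hessForm f x u u ≤ weightedNorm A u ^ 2
  upper : ∀ u, weightedNorm A u ^ 2 ≤ (1 + δ) ^ 2 * hessForm f x u u

namespace IsHessianApprox

variable {x : Vec p} {A : Op p} {δ : ℝ}

lemma of_loewner (hf : ContDiffAt ℝ 3 f x) (hA : IsPosDef A) (h0 : 0 ≤ δ) (h1 : δ < 1)
    (hl : (1 - δ) ^ 2 • hessian f x ≤ A) (hu : A ≤ (1 + δ) ^ 2 • hessian f x) :
    IsHessianApprox f x A δ := by
  refine ⟨hA, h0, h1, fun u => ?_, fun u => ?_⟩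
  · have := (ContinuousLinearMap.le_def _ _).1 hl |>.inner_nonneg_left u
    rw [hA.weightedNorm_sq, ← inner_hessian hf]
    simp only [sub_apply, smul_apply, inner_sub_left, real_inner_smul_left] at this
    linarith
  · have := (ContinuousLinearMap.le_def _ _).1 hu |>.inner_nonneg_left u
    rw [hA.weightedNorm_sq, ← inner_hessian hf]
    simp only [sub_apply, smul_apply, inner_sub_left, real_inner_smul_left] at this
    linarith

/-- Approximate Hessians at nearby points define nearby norms. -/
lemma weightedNorm_le (hA : IsHessianApprox f x A δ) {y : Vec p} {B : Op p}
    (hB : IsHessianApprox f y B δ) {r : ℝ} (hr1 : r < 1)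
    {u : Vec p} (h : (1 - r) ^ 2 * hessForm f x u u ≤ hessForm f y u u) :
    weightedNorm A u ≤ (1 + δ) / ((1 - δ) * (1 - r)) * weightedNorm B u := by
  have h0 := hA.nonneg
  have d1 : 0 < 1 - δ := by linarith [hA.lt_one]
  have r1 : 0 < 1 - r := by linarith
  rw [div_mul_eq_mul_div, le_div_iff₀ (by positivity)]
  refine le_of_sq_le_sq ?_ (mul_nonneg (by linarith) (weightedNorm_nonneg _ _))
  have h1 := hA.upper u
  have h2 := hB.lower u
  calc (weightedNorm A u * ((1 - δ) * (1 - r))) ^ 2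
      = weightedNorm A u ^ 2 * ((1 - δ) ^ 2 * (1 - r) ^ 2) := by ring
    _ ≤ (1 + δ) ^ 2 * hessForm f x u u * ((1 - δ) ^ 2 * (1 - r) ^ 2) := by gcongr
    _ = (1 + δ) ^ 2 * (1 - δ) ^ 2 * ((1 - r) ^ 2 * hessForm f x u u) := by ring
    _ ≤ (1 + δ) ^ 2 * (1 - δ) ^ 2 * hessForm f y u u := by gcongr
    _ = (1 + δ) ^ 2 * ((1 - δ) ^ 2 * hessForm f y u u) := by ring
    _ ≤ (1 + δ) ^ 2 * weightedNorm B u ^ 2 := by gcongr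
    _ = _ := by ring

lemma sqrt_hessForm_smul_le (hA : IsHessianApprox f x A δ) {d : Vec p} {α r : ℝ} (hα : 0 ≤ α)
    (hr : α * weightedNorm A d ≤ r * (1 - δ)) (hr0 : 0 ≤ r) :
    √(hessForm f x (α • d) (α • d)) ≤ r := by
  have d1 : 0 < 1 - δ := by linarith [hA.lt_one]
  refine Real.sqrt_le_iff.2 ⟨hr0, ?_⟩
  have h1 := hA.lower (α • d)
  rw [IsPosDef.weightedNorm_smul, abs_of_nonneg hα] at h1
  have h2 : (α * weightedNorm A d) ^ 2 ≤ (r * (1 - δ)) ^ 2 :=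
    pow_le_pow_left₀ (mul_nonneg hα (weightedNorm_nonneg _ _)) hr 2
  refine le_of_mul_le_mul_left (h1.trans (h2.trans_eq ?_)) (by positivity : 0 < (1 - δ) ^ 2)
  ring

/-- The error of the step `α d` in the linearized optimality condition. -/
lemma inner_sub_gradient_le (hsc : StandardSelfConcordant D f) (hA : IsHessianApprox f x A δ)
    {d : Vec p} {α r : ℝ} (hα : 0 ≤ α)
    (hseg : ∀ t ∈ Set.Icc (0 : ℝ) 1, x + t • (α • d) ∈ D)
    (hr : α * weightedNorm A d ≤ r * (1 - δ)) (hr0 : 0 ≤ r) (hr1 : r < 1)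
    (hdom : ∀ s ∈ Set.Icc 0 r,
      α / ((1 - s) ^ 2 * (1 - δ) ^ 2) + α * (1 - 2 * s) / (1 + δ) ^ 2 ≤ 2)
    (u : Vec p) :
    inner ℝ (A d) u - (inner ℝ (gradient f (x + α • d)) u - inner ℝ (gradient f x) u) ≤
      weightedNorm A d * weightedNorm A u * (1 - α * (1 - r) / (1 + δ) ^ 2) := by
  have h0mem : (0 : ℝ) ∈ Set.Icc (0 : ℝ) 1 := by simp
  have h1mem : (1 : ℝ) ∈ Set.Icc (0 : ℝ) 1 := by simp
  have hx : x ∈ D := by simpa using hseg 0 h0mem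
  have d0 := hA.nonneg
  have d1 : 0 < 1 - δ := by linarith [hA.lt_one]
  have hrh := hA.sqrt_hessForm_smul_le hα hr hr0
  set N := weightedNorm A d * weightedNorm A u with hN
  set b := (1 + δ) ^ 2 with hb
  have hbpos : 0 < b := by positivity
  -- The derivative of the error at time t is (A - α∇²f)(d, u), at most N(1 - α(1 - 2tr)/b).
  -- Replacing (1-tr)² by 1 - 2tr keeps the primitive polynomial.
  have hmono : MonotoneOn (fun t : ℝ => N * (t - α * (t - t ^ 2 * r) / b)
      - (t * inner ℝ (A d) u - fderiv ℝ f (x + t • (α • d)) u)) (Set.Icc 0 1) := by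
    refine monotoneOn_Icc_of_hasDerivAt
      (φ' := fun t => N * (1 - α * (1 - 2 * t * r) / b)
        - (inner ℝ (A d) u - hessForm f (x + t • (α • d)) (α • d) u))
      (fun t ht => ?_) fun t ht => ?_
    · have e1 : HasDerivAt (fun t : ℝ => N * (t - α * (t - t ^ 2 * r) / b))
          (N * (1 - α * (1 - 2 * t * r) / b)) t := by
        have := ((hasDerivAt_id t).sub
          ((((hasDerivAt_id t).sub (((hasDerivAt_id t).pow 2).mul_const r)).const_mul α).div_const
            b)).const_mul N
        simpa using this
      have e2 := ((hasDerivAt_id t).mul_const (inner ℝ (A d) u)).sub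
        (hasDerivAt_fderiv_line (hsc.contDiffAt (hseg t ht)) u)
      rw [one_mul] at e2
      exact e1.sub e2
    · have hft := hsc.contDiffAt (hseg t ht)
      have htr : t * r ∈ Set.Icc 0 r :=
        ⟨mul_nonneg ht.1 hr0, mul_le_of_le_one_left hr0 ht.2⟩
      have ht1 : 0 < 1 - t * r := by linarith [htr.2]
      have hT := hA.posDef.abs_inner_le_of_diag
        (T := A - α • hessian f (x + t • (α • d)))
        (c := 1 - α * (1 - 2 * t * r) / b) (fun u v => by
          simp only [sub_apply, smul_apply, inner_sub_left, real_inner_smul_left,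
            inner_hessian hft, hessForm_symm hft u v, hA.posDef.inner_comm u v])
        (fun v => by
          simp only [sub_apply, smul_apply, inner_sub_left, real_inner_smul_left,
            inner_hessian hft, ← hA.posDef.weightedNorm_sq]
          obtain ⟨hl, hu⟩ := hsc.hessForm_line_bounds hseg hrh hr1 ht v
          have al := hA.lower v
          have au := hA.upper v
          set n2 := weightedNorm A v ^ 2
          have hn2 : 0 ≤ n2 := by positivity
          set q := hessForm f (x + t • (α • d)) v v
          set q0 := hessForm f x v v
          have hq0 : 0 ≤ q0 := hsc.hessForm_nonneg hx v
          rw [abs_le]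
          constructor
          -- `hdom` ensures that the excess of α∇²f over A is bounded by the same constant as its
          -- deficit.
          · have h1 : q ≤ n2 / ((1 - t * r) ^ 2 * (1 - δ) ^ 2) := by
              rw [le_div_iff₀ (by positivity)]
              calc _ = (1 - δ) ^ 2 * ((1 - t * r) ^ 2 * q) := by ring
                _ ≤ (1 - δ) ^ 2 * q0 := by gcongr
                _ ≤ n2 := al
            have h2 := mul_le_mul_of_nonneg_left (hdom _ htr) hn2
            have h3 := mul_le_mul_of_nonneg_left h1 hα
            have e : n2 * (α / ((1 - t * r) ^ 2 * (1 - δ) ^ 2) + α * (1 - 2 * (t * r)) / b)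
              = α * (n2 / ((1 - t * r) ^ 2 * (1 - δ) ^ 2)) + α * (1 - 2 * t * r) / b * n2 := by
              ring
            linarith
          · have h1 : (1 - 2 * t * r) / b * n2 ≤ q := by
              have h2 : n2 / b ≤ q0 := by rw [div_le_iff₀ hbpos]; linarith
              have h3 : 0 ≤ n2 / b := by positivity
              calc _ = (1 - 2 * t * r) * (n2 / b) := by ring
                _ ≤ (1 - t * r) ^ 2 * (n2 / b) :=
                  mul_le_mul_of_nonneg_right (by nlinarith [sq_nonneg (t * r)]) h3
                _ ≤ (1 - t * r) ^ 2 * q0 := by gcongr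
                _ ≤ q := hl
            have h2 := mul_le_mul_of_nonneg_left h1 hα
            have e : α * ((1 - 2 * t * r) / b * n2) = α * (1 - 2 * t * r) / b * n2 := by ring
            linarith) d u
      have h2 := (le_abs_self _).trans hT
      simp only [sub_apply, smul_apply, inner_sub_left, real_inner_smul_left,
        inner_hessian hft] at h2
      have h3 : hessForm f (x + t • (α • d)) (α • d) u
          = α * hessForm f (x + t • (α • d)) d u := by
        simp [hessForm]
      rw [h3]
      linarith
  have := hmono h0mem h1mem zero_le_one
  simp only [zero_smul, add_zero, one_smul] at this
  rw [inner_gradient, inner_gradient]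
  have e : N * (1 - α * (1 - 1 ^ 2 * r) / b) = N * (1 - α * (1 - r) / b) := by ring
  have e0 : N * (0 - α * (0 - 0 ^ 2 * r) / b) = 0 := by simp
  linarith

end IsHessianApprox

/-- One step of the inexact proximal Newton method, with an arbitrary step size `α`. -/
lemma decrement_sq_le (hsc : StandardSelfConcordant D f) {x x' z z' g g' ν ν' : Vec p}
    {A A' : Op p} {DR : Set (Vec p)} {R : Vec p → ℝ} {α r δ₂ δ₃ δ₄ : ℝ}
    (hA : IsHessianApprox f x A δ₃) (hA' : IsHessianApprox f x' A' δ₃)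
    (hx' : x' = x + α • (z - x)) (hα : 0 ≤ α) (hα1 : α ≤ 1)
    (hseg : ∀ t ∈ Set.Icc (0 : ℝ) 1, x + t • (α • (z - x)) ∈ D)
    (hr : α * weightedNorm A (z - x) ≤ r * (1 - δ₃)) (hr0 : 0 ≤ r) (hr1 : r < 1)
    (hdom : ∀ s ∈ Set.Icc 0 r,
      α / ((1 - s) ^ 2 * (1 - δ₃) ^ 2) + α * (1 - 2 * s) / (1 + δ₃) ^ 2 ≤ 2)
    (hg : dualNorm A (g - gradient f x) ≤ δ₂) (hg' : dualNorm A' (g' - gradient f x') ≤ δ₂)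
    (hν : dualNorm A ν ≤ δ₄ * weightedNorm A (z - x))
    (hν' : dualNorm A' ν' ≤ δ₄ * weightedNorm A' (z' - x'))
    (hs : ν - (g + A (z - x)) ∈ subdifferential DR R z)
    (hs' : ν' - (g' + A' (z' - x')) ∈ subdifferential DR R z') {κ lam lam' : ℝ}
    (hκ : κ = (1 + δ₃) / ((1 - δ₃) * (1 - r))) (hlam : lam = weightedNorm A (z - x))
    (hlam' : lam' = weightedNorm A' (z' - x')) :
    lam' ^ 2 ≤ ((1 - α) * κ * lam) ^ 2 + (δ₄ * lam' + δ₂ * (1 + κ)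
      + κ * lam * (δ₄ + (1 - α * (1 - r) / (1 + δ₃) ^ 2))) ^ 2 := by
  obtain ⟨d, hd⟩ : ∃ d, d = z - x := ⟨_, rfl⟩
  obtain ⟨d', hd'⟩ : ∃ d', d' = z' - x' := ⟨_, rfl⟩
  rw [← hd] at hseg hr hν hs hlam hx'
  rw [← hd'] at hν' hs' hlam'
  have d0 := hA.nonneg
  have d1 : 0 < 1 - δ₃ := by linarith [hA.lt_one]
  have r1 : 0 < 1 - r := by linarith
  have hκ0 : 0 ≤ κ := by rw [hκ]; positivity
  have hlam0 : 0 ≤ lam := hlam ▸ weightedNorm_nonneg _ _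
  have hrh := hA.sqrt_hessForm_smul_le hα hr hr0
  have hbd : ∀ u, (1 - r) ^ 2 * hessForm f x u u ≤ hessForm f x' u u ∧
      (1 - r) ^ 2 * hessForm f x' u u ≤ hessForm f x u u := fun u => by
    have := hsc.hessForm_line_bounds hseg hrh hr1 (t := 1) (by simp) u
    simpa [hx'] using this
  have n1 : ∀ u, weightedNorm A u ≤ κ * weightedNorm A' u := fun u =>
    hκ ▸ hA.weightedNorm_le hA' hr1 (hbd u).1
  have n2 : ∀ u, weightedNorm A' u ≤ κ * weightedNorm A u := fun u =>
    hκ ▸ hA'.weightedNorm_le hA hr1 (hbd u).2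
  have hδ₂ : 0 ≤ δ₂ := (dualNorm_nonneg _ _).trans hg
  have hν0 : 0 ≤ δ₄ * lam := hlam ▸ (dualNorm_nonneg _ _).trans hν
  have hν0' : 0 ≤ δ₄ * lam' := hlam' ▸ (dualNorm_nonneg _ _).trans hν'
  set c := 1 - α * (1 - r) / (1 + δ₃) ^ 2 with hc
  have hc0 : 0 ≤ c := by
    rw [hc, sub_nonneg, div_le_one (by positivity)]
    nlinarith
  obtain ⟨b, hb⟩ : ∃ b, b = ν' - ν - (g' - g) + A d := ⟨_, rfl⟩
  have hbn : dualNorm A' b ≤ δ₄ * lam' + δ₂ * (1 + κ) + κ * lam * (δ₄ + c) := by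
    refine hA'.posDef.dualNorm_le (by
      nlinarith [mul_nonneg hκ0 hν0, mul_nonneg hκ0 hδ₂,
        mul_nonneg (mul_nonneg hκ0 hlam0) hc0]) fun u => ?_
    have i1 := hA'.posDef.inner_le_dualNorm ν' u
    have i2 := hA.posDef.inner_le_dualNorm ν (-u)
    have i3 := hA'.posDef.inner_le_dualNorm (g' - gradient f x') (-u)
    have i4 := hA.posDef.inner_le_dualNorm (g - gradient f x) u
    have i5 := hA.inner_sub_gradient_le hsc hα hseg hr hr0 hr1 hdom u
    rw [← hx'] at i5
    have hneg : ∀ B : Op p, weightedNorm B (-u) = weightedNorm B u := fun B => by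
      rw [weightedNorm, weightedNorm]; simp
    rw [hneg, inner_neg_right] at i2 i3
    rw [← hlam] at i5 hν
    rw [← hlam'] at hν'
    have m0 := weightedNorm_nonneg A' u
    have m1 := n1 u
    have j1 := mul_le_mul_of_nonneg_right hν' m0
    have j2 := mul_le_mul hν m1 (weightedNorm_nonneg _ _) hν0
    have j3 := mul_le_mul_of_nonneg_right hg' m0
    have j4 := mul_le_mul hg m1 (weightedNorm_nonneg _ _) hδ₂
    have j5 := mul_le_mul_of_nonneg_left m1 (mul_nonneg hlam0 hc0)
    rw [hb]
    simp only [inner_sub_left, inner_add_left] at i3 i4 ⊢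
    nlinarith
  -- Monotonicity of ∂R: the difference of the two subgradients is b - A'd', and z' - z = d' -
  -- (1-α)d.
  have hkey : 0 ≤ inner ℝ (b - A' d') (d' - (1 - α) • d) := by
    have := subdifferential_mono hs hs'
    have e1 : ν' - (g' + A' d') - (ν - (g + A d)) = b - A' d' := by rw [hb]; abel
    have e2 : z' - z = d' - (1 - α) • d := by
      have h1 : z' = d' + x' := by rw [hd']; abel
      have h2 : z = d + x := by rw [hd]; abel
      rw [h1, h2, hx']; module
    rwa [e1, e2] at this
  have h1 := hA'.posDef.weightedNorm_sq_le_of_inner_nonneg hkey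
  have h2 : weightedNorm A' ((1 - α) • d) ≤ (1 - α) * κ * lam := by
    rw [IsPosDef.weightedNorm_smul, abs_of_nonneg (by linarith), mul_assoc, hlam]
    exact mul_le_mul_of_nonneg_left (n2 d) (by linarith)
  rw [hlam']
  rw [hlam'] at hbn
  refine h1.trans (add_le_add (pow_le_pow_left₀ (weightedNorm_nonneg _ _) h2 2)
    (pow_le_pow_left₀ (dualNorm_nonneg _ _) hbn 2))

end OneStep

/-! ### Numerical constants for the damped step -/

section Numerics

section StepSize

variable {δ δ₃ δ₄ lam : ℝ}

/-- The inverse of the damped step size. -/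
lemma exists_inv_dampedStep (hδ : δ ≤ 1 / 100) (h4 : 0 ≤ δ₄) (h4' : δ₄ ≤ δ) :
    ∃ a, dampedStep δ δ₄ lam = a⁻¹ ∧ 1 + 2 * δ + δ ^ 2 + (1 + δ) * lam ≤ a ∧
      (a - 1 - (1 + δ) * lam) * (1 - δ) ≤ 3 * δ + δ ^ 2 := by
  have h1 : 0 < 1 - δ₄ := by linarith
  refine ⟨(1 + δ) ^ 2 / (1 - δ₄) + (1 + δ) * lam, ?_, ?_, ?_⟩
  · rw [dampedStep, ← inv_div]
    congr 1
    field_simp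
  · have : (1 + δ) ^ 2 ≤ (1 + δ) ^ 2 / (1 - δ₄) := by
      rw [le_div_iff₀ h1]; nlinarith [sq_nonneg (1 + δ)]
    nlinarith
  · have : (1 + δ) ^ 2 / (1 - δ₄) ≤ (1 + δ) ^ 2 / (1 - δ) :=
      div_le_div_of_nonneg_left (sq_nonneg _) (by linarith) (by linarith)
    have h2 : (1 + δ) ^ 2 / (1 - δ) * (1 - δ) = (1 + δ) ^ 2 :=
      div_mul_cancel₀ _ (by linarith)
    nlinarith

/-- With a = 1/α one has κ = (1+δ₃)a/(a(1-δ₃) - λ). This is κ ≤ 1 + λ + 2.1δ with the denominator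
cleared, in the worst case δ₃ = δ. -/
lemma dampedStep_poly_distortion {a : ℝ} (h0 : 0 ≤ δ) (hδ : δ ≤ 1 / 100) (hl : 0 ≤ lam)
    (hl' : lam ≤ 1 / 20) (ha : 1 + 2 * δ + lam ≤ a) :
    (1 + δ) * a ≤ (1 + lam + 21 / 10 * δ) * (a * (1 - δ) - lam) := by
  have c0 : 0 ≤ lam * (1 - δ) + δ * (1 / 10 - 21 / 10 * δ) :=
    add_nonneg (mul_nonneg hl (by linarith)) (mul_nonneg h0 (by linarith))
  have c1 := mul_le_mul_of_nonneg_right ha c0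
  have c2 : 0 ≤ 1 / 10 - lam - 19 / 10 * δ - lam * lam - 41 / 10 * (δ * lam)
      - 42 / 10 * (δ * δ) := by
    have j1 : lam * lam ≤ 1 / 20 * (1 / 20) := by gcongr
    have j2 : δ * lam ≤ 1 / 100 * (1 / 20) := by gcongr
    have j3 : δ * δ ≤ 1 / 100 * (1 / 100) := by gcongr
    linarith
  have c3 := mul_nonneg h0 c2
  linarith

/-- The same reduction for (1-α)κ, which only needs an upper bound on a. -/
lemma dampedStep_poly_remainder {a : ℝ} (h0 : 0 ≤ δ) (hδ : δ ≤ 1 / 100) (hl : 0 ≤ lam)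
    (hl' : lam ≤ 1 / 20) (ha : (a - 1 - (1 + δ) * lam) * (1 - δ) ≤ 3 * δ + δ ^ 2) :
    (a - 1) * (1 + δ) ≤ (lam + 32 / 10 * δ) * (a * (1 - δ) - lam) := by
  refine le_of_mul_le_mul_right ?_ (by linarith : 0 < 1 - δ)
  have c0 : 0 ≤ (1 + δ) - (lam + 32 / 10 * δ) * (1 - δ) := by nlinarith
  have c1 := mul_le_mul_of_nonneg_left ha c0
  have c2 : 0 ≤ 2 / 10 - 8 / 10 * δ - 42 / 10 * δ ^ 2 - 32 / 10 * δ ^ 3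
      - lam * δ * (1 - δ) * (lam + 32 / 10 * δ) := by
    have j1 : δ ^ 2 ≤ (1 / 100) ^ 2 := by gcongr
    have j2 : δ ^ 3 ≤ (1 / 100) ^ 3 := by gcongr
    have j3 : lam * δ * (1 - δ) * (lam + 32 / 10 * δ) ≤
        1 / 20 * (1 / 100) * 1 * (1 / 20 + 32 / 10 * (1 / 100)) := by
      gcongr <;> linarith
    linarith
  have c3 := mul_nonneg h0 c2
  linarith

lemma inv_one_sub_sq_le {s : ℝ} (h0 : 0 ≤ s) (h1 : s ≤ 1 / 20) :
    ((1 - s) ^ 2)⁻¹ ≤ 1 + 2 * s + 4 * s ^ 2 := by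
  rw [inv_le_iff_one_le_mul₀ (by nlinarith)]
  have : 0 ≤ s ^ 2 * (1 - 6 * s + 4 * s ^ 2) := by
    apply mul_nonneg (sq_nonneg s); nlinarith
  linarith

/-- The condition `hdom` of `decrement_sq_le`, multiplied by a = 1/α. -/
lemma dampedStep_poly_domination {a s : ℝ} (hδ : δ ≤ 1 / 100) (h3 : 0 ≤ δ₃) (h3' : δ₃ ≤ δ)
    (hs : 0 ≤ s) (hsl : s ≤ lam) (hl' : lam ≤ 1 / 20) (ha : 1 + 2 * δ + lam ≤ a) :
    ((1 - s) ^ 2)⁻¹ * ((1 - δ₃) ^ 2)⁻¹ + (1 - 2 * s) * ((1 + δ₃) ^ 2)⁻¹ ≤ 2 * a := by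
  have i1 := inv_one_sub_sq_le hs (hsl.trans hl')
  have i2 := inv_one_sub_sq_le h3 (by linarith)
  have i3 : ((1 + δ₃) ^ 2)⁻¹ ≤ 1 := inv_le_one_of_one_le₀ (by nlinarith)
  have i4 : ((1 - s) ^ 2)⁻¹ * ((1 - δ₃) ^ 2)⁻¹ ≤
      (1 + 2 * s + 4 * s ^ 2) * (1 + 2 * δ₃ + 4 * δ₃ ^ 2) :=
    mul_le_mul i1 i2 (by positivity) (by positivity)
  have i5 : (1 - 2 * s) * ((1 + δ₃) ^ 2)⁻¹ ≤ 1 - 2 * s :=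
    mul_le_of_le_one_right (by linarith) i3
  have j1 : 2 * δ₃ + 4 * δ₃ ^ 2 ≤ 3 * δ := by nlinarith
  have j2 : 0 ≤ 2 * δ₃ + 4 * δ₃ ^ 2 := by positivity
  have j3 : 2 * s + 4 * s ^ 2 ≤ 1 / 5 := by nlinarith
  have j4 : 4 * s ^ 2 ≤ lam := by nlinarith
  have j5 := mul_le_mul_of_nonneg_right j3 j2
  linarith

variable {α r κ : ℝ}

set_option maxHeartbeats 800000 in
/-- Numerical bounds for the damped step size and small errors. -/
lemma dampedStep_bounds (hδ : δ ≤ 1 / 100) (h3 : 0 ≤ δ₃) (h3' : δ₃ ≤ δ) (h4 : 0 ≤ δ₄)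
    (h4' : δ₄ ≤ δ) (hl : 0 ≤ lam) (hl' : lam ≤ 1 / 20) (hα : α = dampedStep δ δ₄ lam)
    (hr : r = α * lam / (1 - δ₃)) (hκ : κ = (1 + δ₃) / ((1 - δ₃) * (1 - r))) :
    (0 ≤ α ∧ α ≤ 1 ∧ 0 ≤ r ∧ r < 1) ∧
    (∀ s ∈ Set.Icc 0 r,
      α / ((1 - s) ^ 2 * (1 - δ₃) ^ 2) + α * (1 - 2 * s) / (1 + δ₃) ^ 2 ≤ 2) ∧
    κ ≤ 1 + lam + 21 / 10 * δ ∧ (1 - α) * κ ≤ lam + 32 / 10 * δ ∧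
    κ * (δ₄ + (1 - α * (1 - r) / (1 + δ₃) ^ 2)) ≤ 2 * lam + 63 / 10 * δ - 9 / 10 * lam ^ 2 := by
  obtain ⟨a, ha, ha1, ha2⟩ := exists_inv_dampedStep (lam := lam) hδ h4 h4'
  have hδ0 : 0 ≤ δ := h3.trans h3'
  have d3 : 0 < 1 - δ₃ := by linarith
  rw [ha] at hα
  have hla : 0 ≤ δ * lam := by positivity
  have hsq : 0 ≤ δ ^ 2 := by positivity
  have hsq' : δ ^ 2 ≤ δ / 100 := by nlinarith
  have hla' : δ * lam ≤ δ / 20 := by nlinarith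
  have ha1' : 1 + 2 * δ + lam ≤ a := by nlinarith
  have ha0 : 0 < a := by linarith
  have ha3 : a ≤ 1 + lam + 31 / 10 * δ := by nlinarith
  have hα0 : 0 < α := by rw [hα]; positivity
  have haα : a * α = 1 := by rw [hα]; exact mul_inv_cancel₀ ha0.ne'
  have hα1 : α ≤ 1 := by nlinarith
  have hrd : r * (1 - δ₃) = α * lam := by rw [hr]; field_simp
  have hr0 : 0 ≤ r := by rw [hr]; positivity
  have hrl : r ≤ lam := by
    rw [hr, div_le_iff₀ d3, mul_comm]
    refine mul_le_mul_of_nonneg_left ?_ hl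
    nlinarith
  have hr1 : r < 1 := by linarith
  have hden : 0 < a * (1 - δ₃) - lam := by nlinarith
  have hκ' : κ = (1 + δ₃) * a / (a * (1 - δ₃) - lam) := by
    have h1 : a * ((1 - δ₃) * (1 - r)) = a * (1 - δ₃) - lam := by
      have : a * (r * (1 - δ₃)) = lam := by rw [hrd, ← mul_assoc, haα, one_mul]
      linarith
    have h2 : (1 - δ₃) * (1 - r) ≠ 0 := (mul_pos d3 (by linarith)).ne'
    rw [← h1, hκ]; field_simp
  have hκ1 : κ ≤ 1 + lam + 21 / 10 * δ := by
    rw [hκ', div_le_iff₀ hden]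
    have e1 := dampedStep_poly_distortion hδ0 hδ hl hl' ha1'
    have e2 : (1 + δ₃) * a ≤ (1 + δ) * a := by gcongr
    have e3 : a * (1 - δ) - lam ≤ a * (1 - δ₃) - lam := by nlinarith
    have e4 : 0 ≤ 1 + lam + 21 / 10 * δ := by positivity
    exact e2.trans (e1.trans (mul_le_mul_of_nonneg_left e3 e4))
  have hκ0 : 0 ≤ κ := by rw [hκ']; positivity
  refine ⟨⟨hα0.le, hα1, hr0, hr1⟩, ?_, hκ1, ?_, ?_⟩
  · intro s hs
    have i6 := dampedStep_poly_domination hδ h3 h3' hs.1 (hs.2.trans hrl) hl' ha1'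
    calc _ = α * (((1 - s) ^ 2)⁻¹ * ((1 - δ₃) ^ 2)⁻¹ + (1 - 2 * s) * ((1 + δ₃) ^ 2)⁻¹) := by
          rw [← mul_inv]; ring
      _ ≤ α * (2 * a) := by gcongr
      _ = 2 := by linarith
  · have h1 : (1 - α) * κ = (a - 1) * (1 + δ₃) / (a * (1 - δ₃) - lam) := by
      have : (1 - α) * a = a - 1 := by linarith
      rw [hκ', ← this]; ring
    rw [h1, div_le_iff₀ hden]
    have e1 := dampedStep_poly_remainder hδ0 hδ hl hl' ha2
    have e2 : (a - 1) * (1 + δ₃) ≤ (a - 1) * (1 + δ) :=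
      mul_le_mul_of_nonneg_left (by linarith) (by linarith)
    have e3 : a * (1 - δ) - lam ≤ a * (1 - δ₃) - lam := by nlinarith
    exact e2.trans (e1.trans (mul_le_mul_of_nonneg_left e3 (by positivity)))
  · have h1 : κ * (1 - r) = (1 + δ₃) / (1 - δ₃) := by
      have : (1 - r) ≠ 0 := by linarith
      rw [hκ]; field_simp
    -- Since κ(1-r) = (1+δ₃)/(1-δ₃), the term carrying α no longer depends on r.
    have h2 : κ * (δ₄ + (1 - α * (1 - r) / (1 + δ₃) ^ 2)) =
        κ * (1 + δ₄) - α / ((1 - δ₃) * (1 + δ₃)) := by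
      have e : κ * (δ₄ + (1 - α * (1 - r) / (1 + δ₃) ^ 2)) =
        κ * (1 + δ₄) - α * (κ * (1 - r)) / (1 + δ₃) ^ 2 := by ring
      rw [e, h1]; field_simp
    have h3 : α ≤ α / ((1 - δ₃) * (1 + δ₃)) := by
      rw [le_div_iff₀ (by positivity)]
      nlinarith [mul_nonneg hα0.le (sq_nonneg δ₃)]
    have h4 : κ * (1 + δ₄) ≤ 1 + lam + 3171 / 1000 * δ := by
      calc κ * (1 + δ₄) ≤ (1 + lam + 21 / 10 * δ) * (1 + δ) := by gcongr
        _ ≤ _ := by nlinarith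
    -- Here 1/a = 2 - a + (a-1)²/a, and a - 1 dominates both λ and 0.9λa.
    have h5 : 2 - a + 9 / 10 * lam ^ 2 ≤ α := by
      rw [hα, ← one_div, le_div_iff₀ ha0]
      have e1 : 9 / 10 * lam * a ≤ a - 1 := by nlinarith
      have e2 := mul_le_mul_of_nonneg_left e1 hl
      nlinarith
    rw [h2]
    linarith

end StepSize

/-- The one-step estimate, from the inequality of `decrement_sq_le`. -/
lemma decrement_le_of_sq_le {δ δ₂ δ₄ lam Y P B κ : ℝ} (hδ0 : 0 ≤ δ) (hδ : δ ≤ 1 / 100)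
    (h2 : 0 ≤ δ₂) (h4 : 0 ≤ δ₄) (h4' : δ₄ ≤ δ) (hl : 0 ≤ lam)
    (hl' : lam ≤ 1 / 20) (hY : 0 ≤ Y) (hκ0 : 0 ≤ κ) (hκ : κ ≤ 1 + lam + 21 / 10 * δ) (hP0 : 0 ≤ P)
    (hP : P ≤ lam + 32 / 10 * δ)
    (hB : B ≤ 2 * lam + 63 / 10 * δ - 9 / 10 * lam ^ 2)
    (hB0 : 0 ≤ B)
    (h : Y ^ 2 ≤ (P * lam) ^ 2 + (δ₄ * Y + δ₂ * (1 + κ) + lam * B) ^ 2) :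
    Y ≤ 224 / 100 * lam ^ 2 + 8 * δ * lam + 21 / 10 * δ₂ ∧
    Y ^ 2 ≤ (41 / 10000) ^ 2 + (1 / 100 * Y + 2071 / 1000 * δ₂ + 81 / 10000) ^ 2 := by
  have hκ' : κ ≤ 1071 / 1000 := by linarith
  have m1 : δ₂ * (1 + κ) ≤ 2071 / 1000 * δ₂ := by nlinarith
  have m0 : 0 ≤ δ₂ * (1 + κ) := by positivity
  have m2 : δ₄ * Y ≤ δ * Y := by gcongr
  have hYδ : 0 ≤ δ * Y := by positivity
  constructor
  · set W := 2237 / 1000 * lam ^ 2 + 71 / 10 * δ * lam with hW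
    have hdl : 0 ≤ δ * lam := by positivity
    have hW0 : 0 ≤ W := by positivity
    have hB' : B ≤ 2 * lam + 63 / 10 * δ := by nlinarith [sq_nonneg lam]
    have q1 : (P * lam) ^ 2 ≤ ((lam + 32 / 10 * δ) * lam) ^ 2 := by gcongr
    have q2 : lam * B ≤ lam * (2 * lam + 63 / 10 * δ) := by gcongr
    -- The constant 2.237 is just above √5 = √(1² + 2²).
    have q3 : ((lam + 32 / 10 * δ) * lam) ^ 2 + (lam * (2 * lam + 63 / 10 * δ)) ^ 2 ≤ W ^ 2 := by
      have e1 := sq_nonneg (lam ^ 2)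
      have e2 := sq_nonneg (δ * lam)
      have e3 := mul_nonneg hdl (sq_nonneg lam)
      rw [hW]; linarith
    have q4 : lam * (2 * lam + 63 / 10 * δ) ≤ W := by
      have := sq_nonneg lam
      rw [hW]; linarith
    set m := δ * Y + 2071 / 1000 * δ₂ with hm
    have hm0 : 0 ≤ m := by positivity
    have q5 : (δ₄ * Y + δ₂ * (1 + κ) + lam * B) ^ 2 ≤
        (m + lam * (2 * lam + 63 / 10 * δ)) ^ 2 := by
      refine pow_le_pow_left₀ (by positivity) (by linarith) 2
    have q6 : Y ^ 2 ≤ (m + W) ^ 2 := by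
      have := mul_le_mul_of_nonneg_left q4 hm0
      linarith
    have q7 : Y ≤ m + W := le_of_sq_le_sq q6 (by positivity)
    have q8 : Y * (1 - δ) ≤
        (224 / 100 * lam ^ 2 + 8 * δ * lam + 21 / 10 * δ₂) * (1 - δ) := by
      have e1 : Y * (1 - δ) ≤ 2071 / 1000 * δ₂ + W := by rw [hm] at q7; linarith
      have e2 : δ * δ₂ ≤ 1 / 100 * δ₂ := by gcongr
      have e3 : δ * lam ^ 2 ≤ 1 / 20 * (δ * lam) := by nlinarith
      have e4 : δ * (δ * lam) ≤ 1 / 100 * (δ * lam) := by gcongr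
      have e5 := sq_nonneg lam
      rw [hW] at e1; linarith
    exact le_of_mul_le_mul_right q8 (by linarith)
  · have q1 : P * lam ≤ 41 / 10000 := by nlinarith
    have q2 : lam * B ≤ 81 / 10000 := by
      have : B ≤ 162 / 1000 := by nlinarith
      nlinarith
    have q3 : δ * Y ≤ 1 / 100 * Y := by gcongr
    refine h.trans (add_le_add (pow_le_pow_left₀ (by positivity) q1 2)
      (pow_le_pow_left₀ (by positivity) (by linarith) 2))

end Numerics

/-! ### Estimates of exponentials and the linear rate -/

section LinearRate

/-- Taking n-th powers reduces a rational power of e to a decimal bound on 1/e. -/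
lemma le_exp_neg_div {c : ℝ} (hc : 0 ≤ c) (m n : ℕ) (hn : n ≠ 0)
    (h : c ^ n ≤ (0.36787944116 : ℝ) ^ m) : c ≤ Real.exp (-(m / n : ℝ)) := by
  refine (pow_le_pow_iff_left₀ hc (Real.exp_pos _).le hn).1 (h.trans ?_)
  have hn' : (n : ℝ) ≠ 0 := by exact_mod_cast hn
  have : Real.exp (-(m / n : ℝ)) ^ n = Real.exp (-1) ^ m := by
    rw [← Real.exp_nat_mul, ← Real.exp_nat_mul]; congr 1; field_simp
  rw [this]
  exact pow_le_pow_left₀ (by norm_num) Real.exp_neg_one_gt_d9.le m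

lemma exp_neg_div_le {c : ℝ} (hc : 0 ≤ c) (m n : ℕ) (hn : n ≠ 0)
    (h : (0.3678794412 : ℝ) ^ m ≤ c ^ n) : Real.exp (-(m / n : ℝ)) ≤ c := by
  refine (pow_le_pow_iff_left₀ (Real.exp_pos _).le hc hn).1 (le_trans ?_ h)
  have hn' : (n : ℝ) ≠ 0 := by exact_mod_cast hn
  have : Real.exp (-(m / n : ℝ)) ^ n = Real.exp (-1) ^ m := by
    rw [← Real.exp_nat_mul, ← Real.exp_nat_mul]; congr 1; field_simp
  rw [this]
  exact pow_le_pow_left₀ (Real.exp_pos _).le Real.exp_neg_one_lt_d9.le m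

/-- `c ^ ln (1/ε) ≤ ε ^ q` when `c ≤ e^{-q}`. -/
lemma rpow_log_inv_le {c q ε : ℝ} (hc : 0 ≤ c) (h : c ≤ Real.exp (-q)) (hε : 0 < ε)
    (hε1 : ε ≤ 1) : c ^ Real.log (1 / ε) ≤ ε ^ q := by
  have hL : 0 ≤ Real.log (1 / ε) := Real.log_nonneg (by rw [le_div_iff₀ hε]; linarith)
  refine (Real.rpow_le_rpow hc h hL).trans_eq ?_
  rw [← Real.exp_mul, Real.rpow_def_of_pos hε, one_div, Real.log_inv]
  ring_nf

lemma log_twenty_ge : (2.995 : ℝ) ≤ Real.log 20 := by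
  rw [Real.le_log_iff_exp_le (by norm_num)]
  have h1 : Real.exp (2.995 : ℝ) = Real.exp 1 ^ 3 * Real.exp (-0.005) := by
    rw [← Real.exp_nat_mul, ← Real.exp_add]; norm_num
  have h2 : Real.exp (-0.005) ≤ 1 / 1.005 := by
    rw [Real.exp_neg, ← one_div]
    apply one_div_le_one_div_of_le (by norm_num)
    have := Real.add_one_le_exp (0.005 : ℝ)
    linarith
  have h3 : Real.exp 1 ^ 3 ≤ (2.7182818286 : ℝ) ^ 3 :=
    pow_le_pow_left₀ (Real.exp_pos _).le Real.exp_one_lt_d9.le 3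
  rw [h1]
  calc _ ≤ (2.7182818286 : ℝ) ^ 3 * (1 / 1.005) :=
        mul_le_mul h3 h2 (Real.exp_pos _).le (by positivity)
    _ ≤ 20 := by norm_num

set_option exponentiation.threshold 1000 in
lemma rpow_log_twenty_le : (11 / 50 : ℝ) ^ Real.log 20 ≤ 0.01073 := by
  have h1 : (11 / 50 : ℝ) ^ Real.log 20 ≤ (11 / 50 : ℝ) ^ (2.995 : ℝ) :=
    Real.rpow_le_rpow_of_exponent_ge (by norm_num) (by norm_num) log_twenty_ge
  refine h1.trans ?_
  refine (pow_le_pow_iff_left₀ (by positivity) (by norm_num) (n := 200) (by norm_num)).1 ?_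
  rw [← Real.rpow_mul_natCast (by norm_num)]
  have : (2.995 : ℝ) * (200 : ℕ) = (599 : ℕ) := by norm_num
  rw [this, Real.rpow_natCast]
  norm_num

/-- The bound on the gradient error in the superlinear case, near `ε = 1/20`. -/
lemma rpow_log_inv_le_quadratic {s : ℝ} (hs : 0 < s) (hs1 : s ≤ 1) :
    (11 / 50 : ℝ) ^ Real.log (1 / (s / 20)) ≤ 0.01073 * (s * (1 + s) / 2) := by
  have e : Real.log (1 / (s / 20)) = Real.log 20 + Real.log (1 / s) := by
    rw [← Real.log_mul (by norm_num) (by positivity)]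
    congr 1; field_simp
  rw [e, Real.rpow_add (by norm_num)]
  have h0 : (11 / 50 : ℝ) ≤ Real.exp (-(3 / 2)) := by
    have := le_exp_neg_div (c := 11 / 50) (by norm_num) 3 2 (by norm_num) (by norm_num)
    exact_mod_cast this
  have h1 := rpow_log_inv_le (by norm_num) h0 hs hs1
  have h2 : s ^ (3 / 2 : ℝ) ≤ s * (1 + s) / 2 := by
    have : s ^ (3 / 2 : ℝ) = s * √s := by
      rw [show (3 / 2 : ℝ) = 1 + 1 / 2 by norm_num, Real.rpow_add hs, Real.rpow_one,
        Real.sqrt_eq_rpow]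
    rw [this]
    have h3 : √s ≤ (1 + s) / 2 := by
      have := Real.sq_sqrt hs.le
      nlinarith [sq_nonneg (√s - 1)]
    nlinarith
  exact mul_le_mul rpow_log_twenty_le (h1.trans h2) (by positivity) (by norm_num)

/-- The sharp one-step estimate, near `λ = 1/20`. -/
lemma le_div_twenty_of_sq_le {Y s δ₂ : ℝ} (h2 : 0 ≤ δ₂) (hs : 0.68 ≤ s) (hs1 : s ≤ 1)
    (hδ₂ : δ₂ ≤ 37 / 20 * (0.01073 * (s * (1 + s) / 2)))
    (h : Y ^ 2 ≤ (41 / 10000) ^ 2 + (1 / 100 * Y + 2071 / 1000 * δ₂ + 81 / 10000) ^ 2) :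
    Y ≤ s / 20 := by
  by_contra! hY
  obtain ⟨u, hu⟩ : ∃ u, u = 1 - s := ⟨_, rfl⟩
  have hsu : s = 1 - u := by linarith
  have hu0 : 0 ≤ u := by linarith
  have hu1 : u ≤ 0.32 := by linarith
  set M := 0.041112 * (s * (1 + s) / 2) + 81 / 10000 with hM
  have hM1 : 2071 / 1000 * δ₂ + 81 / 10000 ≤ M := by rw [hM]; nlinarith
  have h1 : Y ^ 2 ≤ (41 / 10000) ^ 2 + (1 / 100 * Y + M) ^ 2 := by
    refine h.trans (add_le_add le_rfl (pow_le_pow_left₀ ?_ (by linarith) 2))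
    have : 0 ≤ Y := by linarith
    positivity
  -- The hypothesis amounts to (0.99Y - M)(1.01Y + M) ≤ 0.0041². Assuming Y > s/20, both factors
  -- have affine lower bounds in u = 1 - s whose product is too large.
  have a1 : 0.00028 + 0.005 * u ≤ 99 / 100 * Y - M := by
    rw [hM]; nlinarith
  have a2 : 0.099 - 0.1124 * u ≤ 101 / 100 * Y + M := by
    rw [hM]; nlinarith
  have a3 : (0.00028 + 0.005 * u) * (0.099 - 0.1124 * u) ≤
      (99 / 100 * Y - M) * (101 / 100 * Y + M) :=
    mul_le_mul a1 a2 (by linarith) (by linarith)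
  nlinarith

section Rates

variable {l : ℕ → ℝ} {δ δ₂ ε t : ℝ}

/-- The bounds for one step of a sequence of Newton decrements. -/
structure DecrementRecursion (l : ℕ → ℝ) (δ δ₂ : ℝ) : Prop where
  nonneg : ∀ k, 0 ≤ l k
  zero_le : l 0 ≤ 1 / 20
  delta_nonneg : 0 ≤ δ
  delta_le : δ ≤ 1 / 100
  delta2_nonneg : 0 ≤ δ₂
  le : ∀ k, l k ≤ 1 / 20 → l (k + 1) ≤ 224 / 100 * l k ^ 2 + 8 * δ * l k + 21 / 10 * δ₂
  sq_le : ∀ k, l k ≤ 1 / 20 →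
    l (k + 1) ^ 2 ≤ (41 / 10000) ^ 2 + (1 / 100 * l (k + 1) + 2071 / 1000 * δ₂ + 81 / 10000) ^ 2

namespace DecrementRecursion

/-- The polynomial bound `le` is too weak here: with δ = 1/100 and the largest admitted δ₂ it
exceeds 1/20 at λ = 1/20. The unsimplified `sq_le` suffices. -/
lemma le_one_div_twenty (h : DecrementRecursion l δ δ₂) (hδ₂ : δ₂ ≤ 37 / 20 * 0.01073) (k : ℕ) :
    l k ≤ 1 / 20 := by
  induction k with
  | zero => exact h.zero_le
  | succ k ih =>
    exact le_div_twenty_of_sq_le h.delta2_nonneg (s := 1) (by norm_num) le_rfl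
      (hδ₂.trans (by norm_num)) (h.sq_le k ih)

/-- A step from a bound `b` on the decrement. -/
lemma step_le (h : DecrementRecursion l δ δ₂) {k : ℕ} {b : ℝ} (hb : l k ≤ b) (hb' : b ≤ 1 / 20) :
    l (k + 1) ≤ 224 / 100 * b ^ 2 + 8 * δ * b + 21 / 10 * δ₂ := by
  have h0 := h.nonneg k
  have h1 := h.delta_nonneg
  exact (h.le k (hb.trans hb')).trans (by gcongr)

lemma linear_rate (h : DecrementRecursion l δ δ₂) (hε : 0 < ε) (hε' : ε < 1 / 20)
    (hδ₂ : δ₂ = 5 * ε / 32) : l ⌊Real.log (1 / ε)⌋₊ ≤ ε := by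
  have hb := h.le_one_div_twenty (by rw [hδ₂]; norm_num; linarith)
  -- For λ ≤ 1/20 and δ ≤ 1/100 the step is λ ↦ 0.192λ + 0.329ε at worst: a contraction by less than
  -- 1/3 with fixed point below ε/2. At the floor, 3^(-k) ≤ e^(-k) ≤ eε ≤ 3ε.
  have main : ∀ k, l k ≤ ε / 2 + (1 / 3) ^ k / 20 := by
    intro k
    induction k with
    | zero => have := h.zero_le; norm_num; linarith
    | succ k ih =>
      have h1 := h.le k (hb k)
      have h2 := h.nonneg k
      have h3 := h.delta_le
      have h4 : 8 * δ * l k ≤ 8 * (1 / 100) * l k := by gcongr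
      have h5 : l k ^ 2 ≤ 1 / 20 * l k := by rw [sq]; gcongr; exact hb k
      have h6 : (0 : ℝ) < (1 / 3) ^ k := by positivity
      rw [pow_succ]
      linarith
  set k := ⌊Real.log (1 / ε)⌋₊ with hk
  have h1 : Real.log (1 / ε) < k + 1 := Nat.lt_floor_add_one _
  have h2 : (1 / 3 : ℝ) ^ k ≤ Real.exp (-1) ^ k := by
    refine pow_le_pow_left₀ (by norm_num) ?_ k
    exact le_trans (by norm_num) Real.exp_neg_one_gt_d9.le
  have h3 : Real.exp (-1) ^ k ≤ Real.exp 1 * ε := by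
    rw [← Real.exp_nat_mul]
    rw [one_div, Real.log_inv] at h1
    calc Real.exp (k * -1) ≤ Real.exp (1 + Real.log ε) := Real.exp_le_exp.2 (by linarith)
      _ = Real.exp 1 * ε := by rw [Real.exp_add, Real.exp_log hε]
  have h4 : Real.exp 1 * ε ≤ 3 * ε := by
    gcongr
    exact Real.exp_one_lt_d9.le.trans (by norm_num)
  have := main k
  linarith

end DecrementRecursion

end Rates

end LinearRate

/-! ### Superlinear and quadratic rates -/

section SuperlinearRates

lemma floor_logb_bounds {B L : ℝ} (hB : 1 < B) (hL : 1 ≤ L) :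
    B ^ ⌊Real.logb B L⌋₊ ≤ L ∧ L < B ^ (⌊Real.logb B L⌋₊ + 1) := by
  have hL0 : 0 < L := by linarith
  constructor
  · have := Nat.floor_le (Real.logb_nonneg hB hL)
    rwa [Real.le_logb_iff_rpow_le hB hL0, Real.rpow_natCast] at this
  · have := Nat.lt_floor_add_one (Real.logb B L)
    rw [Real.logb_lt_iff_lt_rpow hB hL0] at this
    exact_mod_cast this

lemma log_inv_bounds {ε : ℝ} (hε : 0 < ε) (hε' : ε < 1 / 20) :
    2.995 ≤ Real.log (1 / ε) ∧ ε = Real.exp (-Real.log (1 / ε)) := by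
  constructor
  · refine log_twenty_ge.trans (Real.log_le_log (by norm_num) ?_)
    rw [le_div_iff₀ hε]; linarith
  · rw [one_div, Real.log_inv, neg_neg, Real.exp_log hε]

lemma rpow_div_natCast_pow {ε : ℝ} (hε : 0 < ε) (m n : ℕ) (hn : n ≠ 0) :
    ε ^ ((m : ℝ) / n) = (ε ^ (1 / n : ℝ)) ^ m := by
  have hn' : (n : ℝ) ≠ 0 := by exact_mod_cast hn
  rw [← Real.rpow_mul_natCast hε.le]
  congr 1; field_simp

namespace DecrementRecursion

variable {l : ℕ → ℝ} {δ δ₂ ε t : ℝ}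

/-- Put m = max(ε, F') = w⁶. As t ≤ w, every quantity is bounded by a power of w: λ_j ≤ w⁴/2, δ ≤
w³/4, δ₂ ≤ 1.85w⁹. The step gives w⁶ times a quantity below 1. -/
lemma superlinear_step (h : DecrementRecursion l δ δ₂) (ht : 0 ≤ t) (hte : t ^ 6 = ε)
    (hε : ε ≤ 0.0064) (hδ : δ ≤ 1 / 4 * t ^ 3) (hδ₂ : δ₂ ≤ 37 / 20 * t ^ 9) {j : ℕ} {F F' : ℝ}
    (hF0 : 0 ≤ F) (hF0' : 0 ≤ F') (hF : F ^ 3 ≤ F' ^ 2 / 8) (hF' : F' ≤ 0.0064)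
    (hl : l j ≤ max ε F) : l (j + 1) ≤ max ε F' := by
  obtain ⟨m, hm⟩ : ∃ m, m = max ε F' := ⟨_, rfl⟩
  have hm1 : m ≤ 0.0064 := hm ▸ max_le hε hF'
  have hεm : ε ≤ m := hm ▸ le_max_left _ _
  have hF'm : F' ≤ m := hm ▸ le_max_right _ _
  have hm0 : 0 ≤ m := hF0'.trans hF'm
  obtain ⟨w, hw0, hw⟩ : ∃ w : ℝ, 0 ≤ w ∧ w ^ 6 = m :=
    ⟨m ^ (1 / (6 : ℕ) : ℝ), by positivity, by
      rw [← Real.rpow_mul_natCast hm0]; norm_num⟩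
  have hwb : w ≤ 0.431 := by
    refine (pow_le_pow_iff_left₀ hw0 (by norm_num) (n := 6) (by norm_num)).1 ?_
    rw [hw]; exact hm1.trans (by norm_num)
  have htw : t ≤ w := by
    refine (pow_le_pow_iff_left₀ ht hw0 (n := 6) (by norm_num)).1 ?_
    rwa [hw, hte]
  have hw2 : w ^ 2 ≤ 0.186 := (pow_le_pow_left₀ hw0 hwb 2).trans (by norm_num)
  have hw3 : w ^ 3 ≤ 0.0801 := (pow_le_pow_left₀ hw0 hwb 3).trans (by norm_num)
  have hl1 : l j ≤ 1 / 2 * w ^ 4 := by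
    refine hl.trans (max_le ?_ ?_)
    · calc ε ≤ m := hεm
        _ = w ^ 2 * w ^ 4 := by rw [← hw]; ring
        _ ≤ 1 / 2 * w ^ 4 := by gcongr; linarith
    · refine (pow_le_pow_iff_left₀ hF0 (by positivity) (n := 3) (by norm_num)).1 ?_
      calc F ^ 3 ≤ F' ^ 2 / 8 := hF
        _ ≤ m ^ 2 / 8 := by gcongr
        _ = _ := by rw [← hw]; ring
  have hδw : δ ≤ 1 / 4 * w ^ 3 := hδ.trans (by gcongr)
  have hδw' : δ₂ ≤ 37 / 20 * w ^ 9 := hδ₂.trans (by gcongr)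
  have hb : 1 / 2 * w ^ 4 ≤ 1 / 20 := by
    have : w ^ 4 ≤ 0.431 ^ 4 := pow_le_pow_left₀ hw0 hwb 4
    linarith
  have h1 := h.step_le hl1 hb
  rw [← hm]
  calc _ ≤ 224 / 100 * (1 / 2 * w ^ 4) ^ 2 + 8 * (1 / 4 * w ^ 3) * (1 / 2 * w ^ 4)
        + 21 / 10 * (37 / 20 * w ^ 9) := by
        refine h1.trans ?_; gcongr
    _ = w ^ 6 * (56 / 100 * w ^ 2 + w + 3885 / 1000 * w ^ 3) := by ring
    _ ≤ w ^ 6 * 1 := by gcongr; linarith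
    _ = m := by rw [mul_one, hw]

lemma superlinear_rate (h : DecrementRecursion l δ δ₂) (hε : 0 < ε) (hε' : ε < 1 / 20)
    (hδ : δ ≤ 1 / 4 * (3 / 5 : ℝ) ^ Real.log (1 / ε))
    (hδ₂ : δ₂ ≤ 37 / 20 * (11 / 50 : ℝ) ^ Real.log (1 / ε)) :
    l ⌊Real.logb (3 / 2) (Real.log (1 / ε))⌋₊ ≤ ε := by
  obtain ⟨hL, hεL⟩ := log_inv_bounds hε hε'
  obtain ⟨hk1, hk2⟩ := floor_logb_bounds (B := 3 / 2) (by norm_num)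
    (by linarith : 1 ≤ Real.log (1 / ε))
  have hquad : ∀ s : ℝ, 20 * ε ≤ s → s ≤ 1 → δ₂ ≤ 37 / 20 * (0.01073 * (s * (1 + s) / 2)) := by
    intro s hs hs1
    have hs0 : 0 ≤ s := by linarith
    have h1 := rpow_log_inv_le_quadratic (s := 20 * ε) (by positivity) (by linarith)
    rw [show 20 * ε / 20 = ε by ring] at h1
    refine hδ₂.trans (mul_le_mul_of_nonneg_left (h1.trans ?_) (by norm_num))
    gcongr
  have hb := h.le_one_div_twenty ((hquad 1 (by linarith) le_rfl).trans (by norm_num))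
  obtain ⟨t, ht, hte⟩ : ∃ t : ℝ, t = ε ^ (1 / (6 : ℕ) : ℝ) ∧ t ^ 6 = ε :=
    ⟨_, rfl, by rw [← rpow_div_natCast_pow hε 6 6 (by norm_num)]; norm_num⟩
  have ht0 : 0 ≤ t := ht ▸ by positivity
  have hδ' : δ ≤ 1 / 4 * t ^ 3 := by
    have h0 : (3 / 5 : ℝ) ≤ Real.exp (-((3 : ℕ) / (6 : ℕ))) :=
      le_exp_neg_div (by norm_num) 3 6 (by norm_num) (by norm_num)
    have h1 := rpow_log_inv_le (by norm_num) h0 hε (by linarith)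
    rw [rpow_div_natCast_pow hε 3 6 (by norm_num), ← ht] at h1
    linarith
  have hδ₂' : δ₂ ≤ 37 / 20 * t ^ 9 := by
    have h0 : (11 / 50 : ℝ) ≤ Real.exp (-((9 : ℕ) / (6 : ℕ))) :=
      le_exp_neg_div (by norm_num) 9 6 (by norm_num) (by norm_num)
    have h1 := rpow_log_inv_le (by norm_num) h0 hε (by linarith)
    rw [rpow_div_natCast_pow hε 9 6 (by norm_num), ← ht] at h1
    linarith
  have hδ1 := h.delta_le
  have hδ0 := h.delta_nonneg
  generalize ⌊Real.logb (3 / 2) (Real.log (1 / ε))⌋₊ = k at hk1 hk2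
  generalize Real.log (1 / ε) = L at *
  have hδ₂ε : ∀ c : ℝ, t ^ 3 ≤ c → δ₂ ≤ 37 / 20 * (c * ε) := by
    intro c hc
    refine hδ₂'.trans (mul_le_mul_of_nonneg_left ?_ (by norm_num))
    calc t ^ 9 = t ^ 3 * t ^ 6 := by ring
      _ ≤ c * ε := by rw [hte]; gcongr
  have hlt3 : ∀ c : ℝ, 0 ≤ c → ε ≤ c ^ 2 → t ^ 3 ≤ c := by
    intro c hc h1
    refine (pow_le_pow_iff_left₀ (by positivity) hc (n := 2) (by norm_num)).1 ?_
    calc (t ^ 3) ^ 2 = t ^ 6 := by ring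
      _ ≤ c ^ 2 := by rw [hte]; exact h1
  have e27 : Real.exp (-(27 / 8)) ≤ 0.0343 := by
    have := exp_neg_div_le (c := 0.0343) (by norm_num) 27 8 (by norm_num) (by norm_num)
    exact_mod_cast this
  have e27' : 0.034 ≤ Real.exp (-(27 / 8)) := by
    have := le_exp_neg_div (c := 0.034) (by norm_num) 27 8 (by norm_num) (by norm_num)
    exact_mod_cast this
  have e81 : Real.exp (-(81 / 16)) ≤ 0.0064 := by
    have := exp_neg_div_le (c := 0.0064) (by norm_num) 81 16 (by norm_num) (by norm_num)
    exact_mod_cast this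
  have e81' : 0.0063 ≤ Real.exp (-(81 / 16)) := by
    have := le_exp_neg_div (c := 0.0063) (by norm_num) 81 16 (by norm_num) (by norm_num)
    exact_mod_cast this
  -- As ln(1/ε) ≥ 2.995 > (3/2)², k ≤ 1 is impossible. For k = 2, ε ≥ exp(-27/8) gives 20ε ≥ 0.68,
  -- the range of `le_div_twenty_of_sq_le`. For k = 3, three explicit steps suffice.
  rcases (by omega : k ≤ 1 ∨ k = 2 ∨ k = 3 ∨ 4 ≤ k) with hk | rfl | rfl | hk
  · have : (3 / 2 : ℝ) ^ (k + 1) ≤ (3 / 2) ^ 2 := pow_le_pow_right₀ (by norm_num) (by omega)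
    norm_num at this; linarith
  · have hεl : Real.exp (-(27 / 8)) ≤ ε := by
      rw [hεL]; apply Real.exp_le_exp.2; norm_num at hk2; linarith
    have := le_div_twenty_of_sq_le h.delta2_nonneg (s := 20 * ε) (by linarith) (by linarith)
      (hquad _ le_rfl (by linarith)) (h.sq_le 1 (hb 1))
    linarith
  · have hεl : Real.exp (-(81 / 16)) ≤ ε := by
      rw [hεL]; apply Real.exp_le_exp.2; norm_num at hk2; linarith
    have hεu : ε ≤ 0.0343 := by
      refine le_trans ?_ e27
      rw [hεL]; apply Real.exp_le_exp.2; norm_num at hk1; linarith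
    have d2 := hδ₂ε 0.1853 (hlt3 _ (by norm_num) (hεu.trans (by norm_num)))
    have s1 : l 1 ≤ 0.0096 + 0.721 * ε := by
      have := h.step_le (hb 0) le_rfl; norm_num at this; linarith
    have s1' := hb 1
    have s2 : l 2 ≤ 0.00185 + 0.86 * ε := by
      have := h.le 1 s1'
      have h0 := h.nonneg 1
      have q1 : l 1 ^ 2 ≤ 1 / 20 * l 1 := by rw [sq]; gcongr
      have q2 : 8 * δ * l 1 ≤ 8 * (1 / 100) * l 1 := by gcongr
      norm_num at this
      linarith
    have s3 := h.le 2 (hb 2)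
    have h0 := h.nonneg 2
    have q0 : l 2 ≤ 0.0314 := by linarith
    have q1 : l 2 ^ 2 ≤ 0.0314 * l 2 := by rw [sq]; gcongr
    have q2 : 8 * δ * l 2 ≤ 8 * (1 / 100) * l 2 := by gcongr
    norm_num at s3
    linarith
  · have hεu : ε ≤ 0.0064 := by
      refine le_trans ?_ e81
      rw [hεL]; apply Real.exp_le_exp.2
      have : (3 / 2 : ℝ) ^ 4 ≤ (3 / 2) ^ k := pow_le_pow_right₀ (by norm_num) hk
      norm_num at this hk1 ⊢; linarith
    have d2 := hδ₂ε 0.08 (hlt3 _ (by norm_num) (hεu.trans (by norm_num)))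
    have s1 : l 1 ≤ 0.0116 := by
      have := h.step_le (hb 0) le_rfl; norm_num at this; linarith
    have s2 : l 2 ≤ 0.0034 := by
      have := h.step_le s1 (by norm_num); norm_num at this; linarith
    -- The factor 1/8 gives F_j³ = F_{j+1}²/8, as required by `superlinear_step`.
    set F : ℕ → ℝ := fun j => Real.exp (-(3 / 2) ^ (j + 1)) / 8 with hF
    have main : ∀ j, 2 ≤ j → l j ≤ max ε (F j) := by
      intro j hj
      induction j, hj using Nat.le_induction with
      | base =>
        refine le_max_of_le_right ?_
        have : F 2 = Real.exp (-(27 / 8)) / 8 := by rw [hF]; norm_num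
        rw [this]; linarith
      | succ j hj ih =>
        refine h.superlinear_step ht0 hte hεu hδ' hδ₂' (F := F j) (by positivity)
          (by positivity) (le_of_eq ?_) ?_ ih
        · have : Real.exp (-(3 / 2) ^ (j + 1)) ^ 3 = Real.exp (-(3 / 2) ^ (j + 1 + 1)) ^ 2 := by
            rw [← Real.exp_nat_mul, ← Real.exp_nat_mul]
            congr 1; push_cast; ring
          calc F j ^ 3 = Real.exp (-(3 / 2) ^ (j + 1)) ^ 3 / 8 ^ 3 := div_pow _ _ _
            _ = F (j + 1) ^ 2 / 8 := by rw [this, hF]; ring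
        · have : Real.exp (-(3 / 2) ^ (j + 1 + 1)) ≤ Real.exp (-(81 / 16)) := by
            apply Real.exp_le_exp.2
            have : (3 / 2 : ℝ) ^ 4 ≤ (3 / 2) ^ (j + 1 + 1) :=
              pow_le_pow_right₀ (by norm_num) (by omega)
            norm_num at this ⊢; linarith
          rw [hF]
          have h0 := Real.exp_pos (-(3 / 2) ^ (j + 1 + 1))
          simp only; linarith
    refine (main k (by omega)).trans (max_le le_rfl ?_)
    have : Real.exp (-(3 / 2) ^ (k + 1)) ≤ ε := by
      rw [hεL]; apply Real.exp_le_exp.2; linarith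
    have h0 := Real.exp_pos (-(3 / 2) ^ (k + 1))
    rw [hF]; simp only; linarith

/-- The scheme of `superlinear_step` with m = w¹²: now λ_j ≤ 0.6w⁶, and the quadratic term
contributes 2.24·0.36 = 0.8064 < 1, leaving room for the errors. -/
lemma quadratic_step (h : DecrementRecursion l δ δ₂) (ht : 0 ≤ t) (hte : t ^ 12 = ε)
    (hε : ε ≤ 0.000336) (hδ : δ ≤ 1 / 10 * t ^ 9) (hδ₂ : δ₂ ≤ 1 / 5 * t ^ 16) {j : ℕ} {F F' : ℝ}
    (hF0 : 0 ≤ F) (hF0' : 0 ≤ F') (hF : F ^ 2 ≤ 0.36 * F') (hF' : F' ≤ 0.000336)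
    (hl : l j ≤ max ε F) : l (j + 1) ≤ max ε F' := by
  obtain ⟨m, hm⟩ : ∃ m, m = max ε F' := ⟨_, rfl⟩
  have hm1 : m ≤ 0.000336 := hm ▸ max_le hε hF'
  have hεm : ε ≤ m := hm ▸ le_max_left _ _
  have hF'm : F' ≤ m := hm ▸ le_max_right _ _
  have hm0 : 0 ≤ m := hF0'.trans hF'm
  obtain ⟨w, hw0, hw⟩ : ∃ w : ℝ, 0 ≤ w ∧ w ^ 12 = m :=
    ⟨m ^ (1 / (12 : ℕ) : ℝ), by positivity, by
      rw [← Real.rpow_mul_natCast hm0]; norm_num⟩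
  have hwb : w ≤ 0.52 := by
    refine (pow_le_pow_iff_left₀ hw0 (by norm_num) (n := 12) (by norm_num)).1 ?_
    rw [hw]; exact hm1.trans (by norm_num)
  have htw : t ≤ w := by
    refine (pow_le_pow_iff_left₀ ht hw0 (n := 12) (by norm_num)).1 ?_
    rwa [hw, hte]
  have hw3 : w ^ 3 ≤ 0.141 := (pow_le_pow_left₀ hw0 hwb 3).trans (by norm_num)
  have hw4 : w ^ 4 ≤ 0.074 := (pow_le_pow_left₀ hw0 hwb 4).trans (by norm_num)
  have hw6 : w ^ 6 ≤ 0.02 := (pow_le_pow_left₀ hw0 hwb 6).trans (by norm_num)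
  have hl1 : l j ≤ 6 / 10 * w ^ 6 := by
    refine hl.trans (max_le ?_ ?_)
    · calc ε ≤ m := hεm
        _ = w ^ 6 * w ^ 6 := by rw [← hw]; ring
        _ ≤ 6 / 10 * w ^ 6 := by gcongr; linarith
    · refine (pow_le_pow_iff_left₀ hF0 (by positivity) (n := 2) (by norm_num)).1 ?_
      calc F ^ 2 ≤ 0.36 * F' := hF
        _ ≤ 0.36 * m := by gcongr
        _ = _ := by rw [← hw]; ring
  have hδw : δ ≤ 1 / 10 * w ^ 9 := hδ.trans (by gcongr)
  have hδw' : δ₂ ≤ 1 / 5 * w ^ 16 := hδ₂.trans (by gcongr)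
  have h1 := h.step_le hl1 (by linarith)
  rw [← hm]
  calc _ ≤ 224 / 100 * (6 / 10 * w ^ 6) ^ 2 + 8 * (1 / 10 * w ^ 9) * (6 / 10 * w ^ 6)
        + 21 / 10 * (1 / 5 * w ^ 16) := by
        refine h1.trans ?_; gcongr
    _ = w ^ 12 * (8064 / 10000 + 48 / 100 * w ^ 3 + 42 / 100 * w ^ 4) := by ring
    _ ≤ w ^ 12 * 1 := by gcongr; linarith
    _ = m := by rw [mul_one, hw]

lemma quadratic_rate (h : DecrementRecursion l δ δ₂) (hε : 0 < ε) (hε' : ε < 1 / 20)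
    (hδ : δ ≤ 1 / 10 * (19 / 50 : ℝ) ^ Real.log (1 / ε))
    (hδ₂ : δ₂ ≤ 1 / 5 * (13 / 50 : ℝ) ^ Real.log (1 / ε)) :
    l ⌊Real.logb 2 (Real.log (1 / ε))⌋₊ ≤ ε := by
  obtain ⟨hL, hεL⟩ := log_inv_bounds hε hε'
  obtain ⟨hk1, hk2⟩ := floor_logb_bounds (B := 2) (by norm_num)
    (by linarith : 1 ≤ Real.log (1 / ε))
  obtain ⟨t, ht, hte⟩ : ∃ t : ℝ, t = ε ^ (1 / (12 : ℕ) : ℝ) ∧ t ^ 12 = ε :=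
    ⟨_, rfl, by rw [← rpow_div_natCast_pow hε 12 12 (by norm_num)]; norm_num⟩
  have ht0 : 0 ≤ t := ht ▸ by positivity
  have hδ' : δ ≤ 1 / 10 * t ^ 9 := by
    have h0 : (19 / 50 : ℝ) ≤ Real.exp (-((9 : ℕ) / (12 : ℕ))) :=
      le_exp_neg_div (by norm_num) 9 12 (by norm_num) (by norm_num)
    have h1 := rpow_log_inv_le (by norm_num) h0 hε (by linarith)
    rw [rpow_div_natCast_pow hε 9 12 (by norm_num), ← ht] at h1
    linarith
  have hδ₂' : δ₂ ≤ 1 / 5 * t ^ 16 := by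
    have h0 : (13 / 50 : ℝ) ≤ Real.exp (-((16 : ℕ) / (12 : ℕ))) :=
      le_exp_neg_div (by norm_num) 16 12 (by norm_num) (by norm_num)
    have h1 := rpow_log_inv_le (by norm_num) h0 hε (by linarith)
    rw [rpow_div_natCast_pow hε 16 12 (by norm_num), ← ht] at h1
    linarith
  have hδ0 := h.delta_nonneg
  generalize ⌊Real.logb 2 (Real.log (1 / ε))⌋₊ = k at hk1 hk2
  generalize Real.log (1 / ε) = L at *
  have hδ₂ε : ∀ c : ℝ, 0 ≤ c → ε ≤ c ^ 3 → δ₂ ≤ 1 / 5 * (c * ε) := by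
    intro c hc h1
    have h2 : t ^ 4 ≤ c := by
      refine (pow_le_pow_iff_left₀ (by positivity) hc (n := 3) (by norm_num)).1 ?_
      calc (t ^ 4) ^ 3 = t ^ 12 := by ring
        _ ≤ c ^ 3 := by rw [hte]; exact h1
    refine hδ₂'.trans (mul_le_mul_of_nonneg_left ?_ (by norm_num))
    calc t ^ 16 = t ^ 4 * t ^ 12 := by ring
      _ ≤ c * ε := by rw [hte]; gcongr
  -- As t⁹ = ε/t³, a lower bound on ε turns the bound on δ into a multiple of ε.
  have hδε : ∀ c : ℝ, 0 < c → c ^ 4 ≤ ε → δ ≤ 1 / 10 * (ε / c) := by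
    intro c hc h1
    have h2 : c ≤ t ^ 3 := by
      refine (pow_le_pow_iff_left₀ hc.le (by positivity) (n := 4) (by norm_num)).1 ?_
      calc c ^ 4 ≤ t ^ 12 := by rw [hte]; exact h1
        _ = (t ^ 3) ^ 4 := by ring
    refine hδ'.trans (mul_le_mul_of_nonneg_left ?_ (by norm_num))
    rw [le_div_iff₀ hc]
    calc t ^ 9 * c ≤ t ^ 9 * t ^ 3 := by gcongr
      _ = ε := by rw [← hte]; ring
  have e4 : Real.exp (-4) ≤ 0.01832 := by
    have := exp_neg_div_le (c := 0.01832) (by norm_num) 4 1 (by norm_num) (by norm_num)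
    norm_num at this ⊢; exact this
  have e4' : 0.0183 ≤ Real.exp (-4) := by
    have := le_exp_neg_div (c := 0.0183) (by norm_num) 4 1 (by norm_num) (by norm_num)
    norm_num at this ⊢; exact this
  have e8 : Real.exp (-8) ≤ 0.000336 := by
    have := exp_neg_div_le (c := 0.000336) (by norm_num) 8 1 (by norm_num) (by norm_num)
    norm_num at this ⊢; exact this
  have e8' : 0.000335 ≤ Real.exp (-8) := by
    have := le_exp_neg_div (c := 0.000335) (by norm_num) 8 1 (by norm_num) (by norm_num)
    norm_num at this ⊢; exact this
  have h00 := h.zero_le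
  -- k = 0 would force ln(1/ε) < 2. For k = 1 and k = 2, ε ≥ e⁻⁴ and ε ≥ e⁻⁸ are within reach of
  -- explicit steps.
  rcases (by omega : k = 0 ∨ k = 1 ∨ k = 2 ∨ 3 ≤ k) with rfl | rfl | rfl | hk
  · norm_num at hk2; linarith
  · have hεl : Real.exp (-4) ≤ ε := by
      rw [hεL]; apply Real.exp_le_exp.2; norm_num at hk2; linarith
    have d2 := hδ₂ε 0.3685 (by norm_num) (hε'.le.trans (by norm_num))
    have d1 := hδε 0.3677 (by norm_num) (le_trans (by norm_num) (e4'.trans hεl))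
    have := h.step_le h00 le_rfl
    norm_num at this d1; linarith
  · have hεl : Real.exp (-8) ≤ ε := by
      rw [hεL]; apply Real.exp_le_exp.2; norm_num at hk2; linarith
    have hεu : ε ≤ 0.01832 := by
      refine le_trans ?_ e4
      rw [hεL]; apply Real.exp_le_exp.2; norm_num at hk1; linarith
    have d2 := hδ₂ε 0.264 (by norm_num) (hεu.trans (by norm_num))
    have d1 := hδε 0.1352 (by norm_num) (le_trans (by norm_num) (e8'.trans hεl))
    norm_num at d1
    have s1 : l 1 ≤ 0.0056 + 0.407 * ε := by
      have := h.step_le h00 le_rfl; norm_num at this; linarith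
    have h0 := h.nonneg 1
    have q0 : l 1 ≤ 0.0131 := by linarith
    have s2 := h.le 1 (by linarith)
    have q1 : l 1 ^ 2 ≤ 0.0131 * l 1 := by rw [sq]; gcongr
    have q2 : 8 * δ * l 1 ≤ 8 * δ * 0.0131 := by gcongr
    norm_num at s2
    linarith
  · have hεu : ε ≤ 0.000336 := by
      refine le_trans ?_ e8
      rw [hεL]; apply Real.exp_le_exp.2
      have : (2 : ℝ) ^ 3 ≤ 2 ^ k := pow_le_pow_right₀ (by norm_num) hk
      norm_num at this hk1 ⊢; linarith
    have ht3 : t ^ 3 ≤ 0.1354 := by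
      refine (pow_le_pow_iff_left₀ (by positivity) (by norm_num) (n := 4) (by norm_num)).1 ?_
      calc (t ^ 3) ^ 4 = t ^ 12 := by ring
        _ ≤ _ := by rw [hte]; exact hεu.trans (by norm_num)
    have d1 : δ ≤ 0.00025 := by
      have : t ^ 9 ≤ 0.1354 ^ 3 := by
        calc t ^ 9 = (t ^ 3) ^ 3 := by ring
          _ ≤ _ := pow_le_pow_left₀ (by positivity) ht3 3
      norm_num at this; linarith
    have d2 := hδ₂ε 0.07 (by norm_num) (hεu.trans (by norm_num))
    have s1 : l 1 ≤ 0.00572 := by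
      have := h.step_le h00 le_rfl; norm_num at this; linarith
    have s2 : l 2 ≤ 0.00012 := by
      have := h.step_le s1 (by norm_num); norm_num at this; linarith
    set F : ℕ → ℝ := fun j => 0.36 * Real.exp (-2 ^ (j + 1)) with hF
    have main : ∀ j, 2 ≤ j → l j ≤ max ε (F j) := by
      intro j hj
      induction j, hj using Nat.le_induction with
      | base =>
        refine le_max_of_le_right ?_
        have : F 2 = 0.36 * Real.exp (-8) := by rw [hF]; norm_num
        rw [this]; linarith
      | succ j hj ih =>
        refine h.quadratic_step ht0 hte hεu hδ' hδ₂' (F := F j) (by positivity)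
          (by positivity) (le_of_eq ?_) ?_ ih
        · have : Real.exp (-2 ^ (j + 1)) ^ 2 = Real.exp (-2 ^ (j + 1 + 1)) := by
            rw [← Real.exp_nat_mul]
            congr 1; push_cast; ring
          rw [hF]; simp only [mul_pow, this]; ring
        · have : Real.exp (-2 ^ (j + 1 + 1)) ≤ Real.exp (-8) := by
            apply Real.exp_le_exp.2
            have : (2 : ℝ) ^ 3 ≤ 2 ^ (j + 1 + 1) :=
              pow_le_pow_right₀ (by norm_num) (by omega)
            norm_num at this ⊢; linarith
          rw [hF]
          have h0 := Real.exp_pos (-2 ^ (j + 1 + 1))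
          simp only; linarith
    refine (main k (by omega)).trans (max_le le_rfl ?_)
    have : Real.exp (-2 ^ (k + 1)) ≤ ε := by
      rw [hεL]; apply Real.exp_le_exp.2; linarith
    have h0 := Real.exp_pos (-2 ^ (k + 1))
    rw [hF]; simp only; linarith

end DecrementRecursion

end SuperlinearRates

/-! ### Residual bound and application to the algorithm -/

section Algorithm

variable {p : ℕ} {Df DR X : Set (Vec p)} {f R ftil : Vec p → ℝ} {g : Vec p → Vec p}
  {H : Vec p → Op p} {δ₀ δ₁ δ₂ δ₃ δ₄ : ℝ} {x z : ℕ → Vec p}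

lemma IsPosDef.weightedNorm_add_le {A : Op p} (hA : IsPosDef A) (u v : Vec p) :
    weightedNorm A (u + v) ≤ weightedNorm A u + weightedNorm A v := by
  refine le_of_sq_le_sq ?_ (add_nonneg (weightedNorm_nonneg _ _) (weightedNorm_nonneg _ _))
  have h1 := hA.inner_le u v
  have h2 := hA.inner_comm u v
  rw [add_sq, hA.weightedNorm_sq, hA.weightedNorm_sq, hA.weightedNorm_sq]
  simp only [map_add, inner_add_left, inner_add_right]
  linarith

lemma omega_nonneg {τ : ℝ} (hτ : 0 ≤ τ) : 0 ≤ omega τ := by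
  have := Real.log_le_sub_one_of_pos (by linarith : 0 < 1 + τ)
  rw [omega]; linarith

lemma omegaStar_le {τ : ℝ} (hτ' : τ ≤ 1 / 2) : omegaStar τ ≤ 2 * τ ^ 2 := by
  have h0 : 0 < 1 - τ := by linarith
  have h1 := Real.one_sub_inv_le_log_of_pos h0
  have h2 : (1 - τ)⁻¹ ≤ 1 + τ + 2 * τ ^ 2 := by
    rw [inv_le_iff_one_le_mul₀ h0]
    nlinarith [mul_nonneg (sq_nonneg τ) (by linarith : 0 ≤ 1 / 2 - τ)]
  rw [omegaStar]; linarith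

lemma StandardSelfConcordant.add_inner_gradient_le (hsc : StandardSelfConcordant Df f)
    {y w : Vec p} (hw : w ∈ Df) (hy : y ∈ Df) :
    f w + inner ℝ (gradient f w) (y - w) ≤ f y := by
  have h0 : w + (0 : ℝ) • (y - w) ∈ Df := by simpa using hw
  have h1 : w + (1 : ℝ) • (y - w) ∈ Df := by simpa using hy
  have hd : HasDerivAt (fun t : ℝ => f (w + t • (y - w)))
      (fderiv ℝ f (w + (0 : ℝ) • (y - w)) (y - w)) 0 :=
    ((hsc.contDiffAt h0).differentiableAt (by norm_num)).hasFDerivAt.comp_hasDerivAt 0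
      (hasDerivAt_line w (y - w) 0)
  have := (hsc.onLines w hw (y - w)).convexOn.le_slope_of_hasDerivAt h0 h1 zero_lt_one hd
  rw [slope_def_field] at this
  simp only [zero_smul, add_zero, one_smul, add_sub_cancel, sub_zero, div_one] at this
  rw [inner_gradient]
  linarith

namespace LocalInexactOracle

/-- Move from y by ρ in the direction u to y'. Convexity of f, the lower oracle bound at y and the
upper one at y' give ⟨∇f(y) - g(w), y' - y⟩ ≤ ω_*((1+δ₀)(λ+ρ)) + δ₁; divide by ρ. -/
lemma inner_gradient_sub_le (ho : LocalInexactOracle Df f X ftil g H δ₀ δ₁ δ₂ δ₃)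
    (hsc : StandardSelfConcordant Df f) {w y : Vec p} (hw : w ∈ X) {lam ρ : ℝ}
    (hlam : weightedNorm (H w) (y - w) = lam) (hρ : 0 < ρ)
    (hb : (1 + δ₀) * (lam + ρ) ≤ 1 / 2) (u : Vec p) :
    inner ℝ (gradient f y - g w) u ≤ (8 * (lam + ρ) ^ 2 + δ₁) / ρ * weightedNorm (H w) u := by
  have hA := ho.posDef w hw
  have d0 := ho.delta0_nonneg
  have d0' := ho.delta0_lt_one
  have hlam0 : 0 ≤ lam := hlam ▸ weightedNorm_nonneg _ _
  rcases (weightedNorm_nonneg (H w) u).eq_or_lt with hu | hu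
  · rw [hA.eq_zero_of_weightedNorm_eq_zero hu.symm]; simp [weightedNorm]
  have hball : ∀ a : ℝ, a ≤ lam + ρ → a < 1 / (1 + δ₀) := fun a ha => by
    rw [lt_div_iff₀ (by linarith)]; nlinarith
  set n := weightedNorm (H w) u with hn
  set y' := y + (ρ / n) • u with hy'
  have hy'n : weightedNorm (H w) (y' - w) ≤ lam + ρ := by
    have e : y' - w = (y - w) + (ρ / n) • u := by rw [hy']; abel
    rw [e, ← hlam]
    refine (hA.weightedNorm_add_le _ _).trans (add_le_add le_rfl (le_of_eq ?_))
    rw [IsPosDef.weightedNorm_smul, abs_of_pos (by positivity), ← hn, div_mul_cancel₀ _ hu.ne']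
  have hyD := ho.mem_dom w hw y (hball _ (by rw [hlam]; linarith))
  have hy'D := ho.mem_dom w hw y' (hball _ hy'n)
  have i1 := ho.lower w hw y (hball _ (by rw [hlam]; linarith))
  have i2 := ho.upper w hw y' (hball _ hy'n)
  have i3 := hsc.add_inner_gradient_le hyD hy'D
  have i4 : 0 ≤ omega ((1 - δ₀) * weightedNorm (H w) (y - w)) :=
    omega_nonneg (mul_nonneg (by linarith) (weightedNorm_nonneg _ _))
  have i5 : (1 + δ₀) * weightedNorm (H w) (y' - w) ≤ (1 + δ₀) * (lam + ρ) := by gcongr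
  have i6 : 0 ≤ (1 + δ₀) * weightedNorm (H w) (y' - w) :=
    mul_nonneg (by linarith) (weightedNorm_nonneg _ _)
  have i7 := omegaStar_le (i5.trans hb)
  have i8 : ((1 + δ₀) * weightedNorm (H w) (y' - w)) ^ 2 ≤ (2 * (lam + ρ)) ^ 2 :=
    pow_le_pow_left₀ i6 (i5.trans (by gcongr; linarith)) 2
  have e1 : inner ℝ (g w) (y' - w) = inner ℝ (g w) (y - w) + inner ℝ (g w) (y' - y) := by
    rw [← inner_add_right]; congr 1; abel
  have e2 : y' - y = (ρ / n) • u := by rw [hy']; abel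
  have i9 : inner ℝ (gradient f y - g w) (y' - y) ≤ 8 * (lam + ρ) ^ 2 + δ₁ := by
    rw [inner_sub_left]; linarith
  rw [e2, real_inner_smul_right, div_mul_eq_mul_div, div_le_iff₀ hu] at i9
  rw [div_mul_eq_mul_div, le_div_iff₀ hρ]
  linarith

/-- The residual of an inexact proximal Newton step. -/
lemma subgradientResidual_le (ho : LocalInexactOracle Df f X ftil g H δ₀ δ₁ δ₂ δ₃)
    (hsc : StandardSelfConcordant Df f) (h4 : δ₄ < 1) {w y ν : Vec p} (hw : w ∈ X)
    (hν : dualNorm (H w) ν ≤ δ₄ * weightedNorm (H w) (y - w))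
    (hs : ν - (g w + H w (y - w)) ∈ subdifferential DR R y)
    (hlam : weightedNorm (H w) (y - w) ≤ 1 / (4 * (1 + δ₀))) (hδ₁ : δ₁ ≤ 1) :
    (subdifferential (Df ∩ DR) (fun u => f u + R u) y).Nonempty ∧
      subgradientResidual Df f DR R (H w) y ≤ 200 * (weightedNorm (H w) (y - w) + √δ₁) := by
  have hA := ho.posDef w hw
  have d0 := ho.delta0_nonneg
  have d0' := ho.delta0_lt_one
  have d1 := ho.delta1_nonneg
  obtain ⟨lam, hl⟩ : ∃ lam, weightedNorm (H w) (y - w) = lam := ⟨_, rfl⟩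
  rw [hl] at hlam hν ⊢
  have hlam0 : 0 ≤ lam := hl ▸ weightedNorm_nonneg _ _
  have hlam1 : (1 + δ₀) * lam ≤ 1 / 4 := by
    rw [le_div_iff₀ (by linarith)] at hlam; linarith
  have hyD : y ∈ Df := by
    refine ho.mem_dom w hw y ?_
    rw [hl, lt_div_iff₀ (by linarith)]; linarith
  set s := ν - (g w + H w (y - w)) with hsdef
  have hmem : gradient f y + s ∈ subdifferential (Df ∩ DR) (fun u => f u + R u) y := by
    refine ⟨⟨hyD, hs.1⟩, fun u hu => ?_⟩
    have h1 := hsc.add_inner_gradient_le hyD hu.1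
    have h2 := hs.2 u hu.2
    simp only [inner_add_left]
    linarith
  refine ⟨⟨_, hmem⟩, ?_⟩
  refine le_trans (csInf_le ⟨0, ?_⟩ (Set.mem_image_of_mem _ hmem)) ?_
  · rintro _ ⟨v, -, rfl⟩; exact dualNorm_nonneg _ _
  have hsq0 := Real.sqrt_nonneg δ₁
  have hsq := Real.sq_sqrt d1
  have hsq1 : √δ₁ ≤ 1 := Real.sqrt_le_one.2 hδ₁
  set S := lam + √δ₁ with hS
  have hS0 : 0 ≤ S := by positivity
  have hlam2 : lam ≤ 1 / 4 := by nlinarith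
  have hSsq : δ₁ ≤ S ^ 2 := by rw [← hsq, hS]; gcongr; linarith
  have main : ∀ η : ℝ, 0 < η → η ≤ 1 / 2 →
      dualNorm (H w) (gradient f y + s) ≤ 163 * S + 161 * η := by
    intro η hη hη1
    refine hA.dualNorm_le (by positivity) fun u => ?_
    -- Balancing λ²/ρ, ρ and δ₁/ρ calls for ρ of order λ + √δ₁. The divisor 16 keeps (1+δ₀)ρ ≤ 1/4,
    -- and η > 0 covers λ = δ₁ = 0; it is sent to 0 at the end.
    obtain ⟨ρ, hρ⟩ : ∃ ρ, ρ = (S + η) / 16 := ⟨_, rfl⟩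
    have hρ0 : 0 < ρ := by rw [hρ]; positivity
    have hρ1 : (1 + δ₀) * ρ ≤ 1 / 4 := by
      have : ρ ≤ 1 / 8 := by rw [hρ, hS]; linarith
      nlinarith
    have i1 := ho.inner_gradient_sub_le hsc hw hl hρ0 (by linarith) u
    have hn := weightedNorm_nonneg (H w) u
    have i2 : (8 * (lam + ρ) ^ 2 + δ₁) / ρ ≤ 161 * (S + η) := by
      have hlS : lam ≤ 16 * ρ := by rw [hρ]; linarith
      have hSρ : S ≤ 16 * ρ := by rw [hρ]; linarith
      rw [div_le_iff₀ hρ0]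
      have j1 : (lam + ρ) ^ 2 ≤ (17 * ρ) ^ 2 :=
        pow_le_pow_left₀ (by positivity) (by linarith) 2
      have j2 : S ^ 2 ≤ (16 * ρ) ^ 2 := pow_le_pow_left₀ hS0 hSρ 2
      have j3 : S + η = 16 * ρ := by rw [hρ]; ring
      rw [j3]; nlinarith
    have i3 := hA.inner_le_dualNorm ν u
    have i4 := hA.inner_le (y - w) (-u)
    have hneg : weightedNorm (H w) (-u) = weightedNorm (H w) u := by
      rw [weightedNorm, weightedNorm]; simp
    rw [hneg, inner_neg_right, hl] at i4
    have i5 : dualNorm (H w) ν * weightedNorm (H w) u ≤ lam * weightedNorm (H w) u := by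
      refine mul_le_mul_of_nonneg_right (hν.trans ?_) hn
      nlinarith
    have i6 := mul_le_mul_of_nonneg_right i2 hn
    have i7 : lam * weightedNorm (H w) u ≤ S * weightedNorm (H w) u :=
      mul_le_mul_of_nonneg_right (by rw [hS]; linarith) hn
    rw [hsdef]
    simp only [inner_add_left, inner_sub_left] at i1 ⊢
    linarith
  have : dualNorm (H w) (gradient f y + s) ≤ 163 * S := by
    refine le_of_forall_pos_le_add fun ε hε => ?_
    have h1 := main (min (1 / 2) (ε / 161)) (by positivity) (min_le_left _ _)
    have h2 := min_le_right (1 / 2) (ε / 161)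
    linarith
  linarith

lemma isHessianApprox (ho : LocalInexactOracle Df f X ftil g H δ₀ δ₁ δ₂ δ₃)
    (hsc : StandardSelfConcordant Df f) {w : Vec p} (hw : w ∈ X) :
    IsHessianApprox f w (H w) δ₃ :=
  .of_loewner (hsc.contDiffAt (ho.subset_dom hw)) (ho.posDef w hw) ho.delta3_nonneg
    ho.delta3_lt_one (ho.hessian_lower w hw) (ho.hessian_upper w hw)

end LocalInexactOracle

/-- The one-step estimate for the inexact proximal Newton algorithm. -/
lemma IsDampedIPNA.decrement_succ_le (hip : IsDampedIPNA DR R g H δ₀ δ₄ x z)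
    (hconv : Convex ℝ Df) (hsc : StandardSelfConcordant Df f)
    (ho : LocalInexactOracle Df f X ftil g H δ₀ δ₁ δ₂ δ₃) (h4 : 0 ≤ δ₄) (hX : ∀ k, x k ∈ X)
    (h3' : δ₃ ≤ δ₀) (h4' : δ₄ ≤ δ₀) (hδ : δ₀ ≤ 1 / 100) {k : ℕ}
    (hk : decrement H x z k ≤ 1 / 20) :
    decrement H x z (k + 1) ≤ 224 / 100 * decrement H x z k ^ 2 + 8 * δ₀ * decrement H x z k
        + 21 / 10 * δ₂ ∧
      decrement H x z (k + 1) ^ 2 ≤ (41 / 10000) ^ 2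
        + (1 / 100 * decrement H x z (k + 1) + 2071 / 1000 * δ₂ + 81 / 10000) ^ 2 := by
  obtain ⟨ν, hs, hν⟩ := hip.stopping k
  obtain ⟨ν', hs', hν'⟩ := hip.stopping (k + 1)
  have hA := ho.isHessianApprox hsc (hX k)
  have hA' := ho.isHessianApprox hsc (hX (k + 1))
  have h3 := ho.delta3_nonneg
  have hl0 : 0 ≤ decrement H x z k := weightedNorm_nonneg _ _
  have hl0' : 0 ≤ decrement H x z (k + 1) := weightedNorm_nonneg _ _
  have hstep := hip.step k
  obtain ⟨lam, hlam⟩ : ∃ lam, lam = decrement H x z k := ⟨_, rfl⟩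
  obtain ⟨lam', hlam'⟩ : ∃ lam', lam' = decrement H x z (k + 1) := ⟨_, rfl⟩
  rw [← hlam] at hstep hk hl0 ⊢
  rw [← hlam'] at hl0' ⊢
  obtain ⟨α, hα⟩ : ∃ α, α = dampedStep δ₀ δ₄ lam := ⟨_, rfl⟩
  rw [← hα] at hstep
  obtain ⟨r, hr⟩ : ∃ r, r = α * lam / (1 - δ₃) := ⟨_, rfl⟩
  obtain ⟨κ, hκ⟩ : ∃ κ, κ = (1 + δ₃) / ((1 - δ₃) * (1 - r)) := ⟨_, rfl⟩
  obtain ⟨⟨hα0, hα1, hr0, hr1⟩, hdom, b1, b2, b3⟩ :=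
    dampedStep_bounds hδ h3 h3' h4 h4' hl0 hk hα hr hκ
  have d3 : 0 < 1 - δ₃ := by linarith
  have hκ0 : 0 ≤ κ := by
    have : 0 < 1 - r := by linarith
    rw [hκ]; positivity
  have hseg : ∀ t ∈ Set.Icc (0 : ℝ) 1, x k + t • (α • (z k - x k)) ∈ Df := fun t ht =>
    hconv.add_smul_mem (ho.subset_dom (hX k)) (hstep ▸ ho.subset_dom (hX (k + 1))) ht
  have hrd : α * weightedNorm (H (x k)) (z k - x k) ≤ r * (1 - δ₃) := by
    rw [hr, div_mul_cancel₀ _ d3.ne', hlam, decrement]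
  have hsq := decrement_sq_le hsc hA hA' hstep hα0 hα1 hseg hrd hr0 hr1 hdom
    (ho.gradient_error _ (hX k)) (ho.gradient_error _ (hX (k + 1))) hν hν' hs hs' hκ hlam hlam'
  have hc0 : 0 ≤ 1 - α * (1 - r) / (1 + δ₃) ^ 2 := by
    rw [sub_nonneg, div_le_one (by positivity)]
    nlinarith
  refine decrement_le_of_sq_le (P := (1 - α) * κ)
    (B := κ * (δ₄ + (1 - α * (1 - r) / (1 + δ₃) ^ 2)))
    ho.delta0_nonneg hδ ho.delta2_nonneg h4 h4' hl0 hk hl0' hκ0 b1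
    (mul_nonneg (by linarith) hκ0) b2 b3 (by positivity) ?_
  convert hsq using 3
  ring

end Algorithm

end InexactProxNewton

/-! ### Assembly of the theorem -/

theorem theorem4p4 :
    -- absolute constants of the two `O`-bounds; `K c₁ c₂` depends on the constants in the
    -- hypotheses `λ_k ≤ c₁ ε` and `δ₁ ≤ c₂ ε²` only
    ∃ (C : ℝ) (K : ℝ → ℝ → ℝ), 0 < C ∧ (∀ c₁ c₂ : ℝ, 0 < c₁ → 0 < c₂ → 0 < K c₁ c₂) ∧
    ∀ (p : ℕ) (Df : Set (Vec p)) (f : Vec p → ℝ) (DR : Set (Vec p)) (R : Vec p → ℝ)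
      (X : Set (Vec p)) (ftil : Vec p → ℝ) (g : Vec p → Vec p) (H : Vec p → Op p)
      (δ₀ δ₁ δ₂ δ₃ δ₄ : ℝ) (x z : ℕ → Vec p),
      ProperClosedConvex Df f → StandardSelfConcordant Df f → ProperClosedConvex DR R →
      LocalInexactOracle Df f X ftil g H δ₀ δ₁ δ₂ δ₃ →
      0 ≤ δ₄ → δ₄ < 1 →
      IsDampedIPNA DR R g H δ₀ δ₄ x z →
      x 0 ∈ Df ∩ DR → (∀ k, x k ∈ X) →
      -- the one-step estimate and the local convergence rates
      (∀ δ : ℝ, δ₃ ≤ δ → δ₄ ≤ δ → δ ≤ 1 / 100 → δ₀ = δ →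
        (∀ k, decrement H x z k ≤ 1 / 20 →
          decrement H x z (k + 1) ≤
            (41 * decrement H x z k ^ 2 + 125 * δ * decrement H x z k + 21 * δ₂) / 10) ∧
        (∀ ε : ℝ, 0 < ε → ε < 1 / 20 → decrement H x z 0 ≤ 1 / 20 →
          -- linear rate
          (δ₂ = 5 * ε / 32 →
            decrement H x z ⌊Real.log (1 / ε)⌋₊ ≤ ε) ∧
          -- superlinear rate
          (δ ≤ 1 / 4 * (3 / 5 : ℝ) ^ Real.log (1 / ε) →
            δ₂ ≤ 37 / 20 * (11 / 50 : ℝ) ^ Real.log (1 / ε) →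
            decrement H x z ⌊Real.logb (3 / 2) (Real.log (1 / ε))⌋₊ ≤ ε) ∧
          -- quadratic rate
          (δ ≤ 1 / 10 * (19 / 50 : ℝ) ^ Real.log (1 / ε) →
            δ₂ ≤ 1 / 5 * (13 / 50 : ℝ) ^ Real.log (1 / ε) →
            decrement H x z ⌊Real.logb 2 (Real.log (1 / ε))⌋₊ ≤ ε))) ∧
      -- the subgradient residual
      (∀ k, decrement H x z k ≤ 1 / (4 * (1 + δ₀)) → δ₁ ≤ 1 →
        (subdifferential (Df ∩ DR) (fun u => f u + R u) (z k)).Nonempty ∧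
        subgradientResidual Df f DR R (H (x k)) (z k) ≤ C * (decrement H x z k + √δ₁)) ∧
      (∀ c₁ c₂ ε : ℝ, 0 < c₁ → 0 < c₂ → 0 < ε → ∀ k,
        decrement H x z k ≤ c₁ * ε → c₁ * ε ≤ 1 / (4 * (1 + δ₀)) →
        δ₁ ≤ c₂ * ε ^ 2 → c₂ * ε ^ 2 ≤ 1 →
        subgradientResidual Df f DR R (H (x k)) (z k) ≤ K c₁ c₂ * ε) := by
  -- K = C(c₁ + √c₂), since δ₁ ≤ c₂ε² gives √δ₁ ≤ √c₂·ε.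
  refine ⟨200, fun c₁ c₂ => 200 * (c₁ + √c₂), by norm_num, fun c₁ c₂ h1 _ => by positivity, ?_⟩
  intro p Df f DR R X ftil g H δ₀ δ₁ δ₂ δ₃ δ₄ x z hf hsc _ ho h4 h4' hip _ hX
  have hres : ∀ k, decrement H x z k ≤ 1 / (4 * (1 + δ₀)) → δ₁ ≤ 1 →
      (subdifferential (Df ∩ DR) (fun u => f u + R u) (z k)).Nonempty ∧
      subgradientResidual Df f DR R (H (x k)) (z k) ≤ 200 * (decrement H x z k + √δ₁) := by
    intro k hk hδ₁
    obtain ⟨ν, hs, hν⟩ := hip.stopping k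
    exact ho.subgradientResidual_le hsc h4' (hX k) hν hs hk hδ₁
  refine ⟨?_, hres, ?_⟩
  · intro δ h3δ h4δ hδ hδ₀
    rw [← hδ₀] at h3δ h4δ hδ ⊢
    have hstep := fun k (hk : decrement H x z k ≤ 1 / 20) =>
      hip.decrement_succ_le hf.convexOn.1 hsc ho h4 hX h3δ h4δ hδ hk
    have hl : ∀ k, 0 ≤ decrement H x z k := fun k => weightedNorm_nonneg _ _
    have d0 := ho.delta0_nonneg
    have d2 := ho.delta2_nonneg
    refine ⟨fun k hk => ?_, fun ε hε hε' h0 => ?_⟩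
    · have h1 := (hstep k hk).1
      have h2 := mul_nonneg d0 (hl k)
      have h3 := sq_nonneg (decrement H x z k)
      linarith
    · have hrec : DecrementRecursion (decrement H x z) δ₀ δ₂ :=
        ⟨hl, h0, d0, hδ, d2, fun k hk => (hstep k hk).1, fun k hk => (hstep k hk).2⟩
      exact ⟨hrec.linear_rate hε hε', hrec.superlinear_rate hε hε', hrec.quadratic_rate hε hε'⟩
  · intro c₁ c₂ ε h1 h2 hε k hk hk' hδ₁ hδ₁'
    refine (hres k (hk.trans hk') (hδ₁.trans hδ₁')).2.trans ?_
    have : √δ₁ ≤ √c₂ * ε := by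
      refine (Real.sqrt_le_sqrt hδ₁).trans_eq ?_
      rw [Real.sqrt_mul h2.le, Real.sqrt_sq hε.le]
    linarith
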